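/- Let $(K,J,g)$ be a compact Kähler manifold and let $\psi$ be a Kähler isometry of $K$, i.e. a biholomorphism $\psi:K\to K$ with $\psi^*g=g$. Let $f=(\psi,\mathrm{Id}_{S^3})$ on $K\times S^3$, where $S^3\subset\mathbb C^2$ is the unit sphere, and let $M_f=(K\times S^3\times\mathbb R)/\mathbb Z$ be its mapping torus, where $n\in\mathbb Z$ acts by $(p,q,t)\mapsto(\psi^n(p),q,t+n)$. The homeomorphism $(p,x)\mapsto(p,x/\|x\|,\log_2\|x\|)$ from $K\times(\mathbb C^2\setminus\{0\})$ to $K\times S^3\times\mathbb R$, followed by the quotient map, gives a covering $\pi:K\times(\mathbb C^2\setminus\{0\})\to M_f$, whose deck transformations are $(p,x)\mapsto(\psi^n(p),2^nx)$. The product complex structure descends through $\pi$ to a complex structure $I$ on $M_f$. Let $h$ be the metric on $M_f$ induced through $\pi$ by the product metric $\tilde g=g+\frac{1}{R^2}g_E$, where $g_E$ is the Euclidean metric of $\mathbb C^2$ and $R=\|x\|$. For a Hermitian metric with fundamental form $\omega=h(I\cdot,\cdot)$, let $\nabla^B$ be the Bismut connection, i.e. the unique connection preserving the metric and the complex structure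 whose torsion, lowered with the metric, is a $3$-form $H$; explicitly $H(X,Y,Z)=d\omega(IX,IY,IZ)$ and $h(\nabla^B_XY,Z)=h(\nabla^{LC}_XY,Z)+\frac12H(X,Y,Z)$. Let $R^B$ be its curvature, $R^B(X,Y,Z,W)=h(R^B(X,Y)Z,W)$, and let $\rho^B(X,Y)=\frac12\sum_iR^B(X,Y,Ie_i,e_i)$ for an orthonormal frame $(e_i)$. The metric is SKT if $dH=0$ and CYT if $\rho^B=0$. Suppose that $g$ is Ricci-flat and not flat. Then $(M_f,I)$ is a complex manifold, $h$ is a well-defined smooth Hermitian metric on it with $\pi^*h=\tilde g$, and $h$ is SKT and CYT. Its Bismut connection is not flat, and the Bismut curvature equals the Riemannian curvature of the $K$ factor: for all $(p,x)\in K\times(\mathbb C^2\setminus\{0\})$ and all tangent vectors $u_i=(u_i',u_i'')\in T_pK\oplus\mathbb C^2$, $1\le i\le4$, $$R^B_{\pi(p,x)}(d\pi u_1,d\pi u_2,d\pi u_3,d\pi u_4)=R^{g}_p(u_1',u_2',u_3',u_4'),$$ where $R^g(X,Y,Z,W)=g(R^g(X,Y)Z,W)$ is the Riemannian curvature tensor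 of $(K,g)$. -/

import Mathlib

open scoped Manifold ContDiff Topology

noncomputable section

/-! ## Hermitian geometry in a holomorphic coordinate

`F` is a finite dimensional complex vector space, `G : F → F →L[ℝ] F →L[ℝ] ℝ` is the coordinate
expression of a Riemannian metric on an open subset of `F`. The complex structure is multiplication
by the imaginary unit, so it has constant coefficients. All tensors are evaluated on constant
coordinate vector fields. -/

namespace HermitianCoord

variable {F : Type*} [NormedAddCommGroup F] [NormedSpace ℂ F]

/-- The complex structure `J` (multiplication by the imaginary unit) as a real linear map. -/
def J : F →L[ℝ] F := (Complex.I • ContinuousLinearMap.id ℂ F).restrictScalars ℝ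

/-- The fundamental form `ω(u, v) = G(J u, v)`. -/
def fundamentalForm (G : F → F →L[ℝ] F →L[ℝ] ℝ) (y : F) : F →L[ℝ] F →L[ℝ] ℝ := (G y).comp J

/-- The exterior derivative of a two-form,
`dα(u, v, w) = ∂_u α(v, w) - ∂_v α(u, w) + ∂_w α(u, v)`, as a linear functional of `w`. -/
def extDeriv₂ (α : F → F →L[ℝ] F →L[ℝ] ℝ) (y u v : F) : F →L[ℝ] ℝ :=
  fderiv ℝ α y u v - fderiv ℝ α y v u + ((fderiv ℝ α y).flip u).flip v

/-- The exterior derivative of a three-form,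
`dH(u, v, w, z) = ∂_u H(v, w, z) - ∂_v H(u, w, z) + ∂_w H(u, v, z) - ∂_z H(u, v, w)`. -/
def extDeriv₃ (H : F → F → F → F → ℝ) (y u v w z : F) : ℝ :=
  fderiv ℝ (fun y' ↦ H y' v w z) y u - fderiv ℝ (fun y' ↦ H y' u w z) y v
    + fderiv ℝ (fun y' ↦ H y' u v z) y w - fderiv ℝ (fun y' ↦ H y' u v w) y z

/-- The Bismut torsion three-form `H(u, v, w) = dω(J u, J v, J w)`, that is `H = - d^c ω`,
as a linear functional of `w`. -/
def torsionForm (G : F → F →L[ℝ] F →L[ℝ] ℝ) (y u v : F) : F →L[ℝ] ℝ :=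
  (extDeriv₂ (fundamentalForm G) y (J u) (J v)).comp J

/-- The Levi-Civita connection `∇_u v`, determined by
`2 G(∇_u v, w) = ∂_u G(v, w) + ∂_v G(u, w) - ∂_w G(u, v)`. -/
def leviCivita (G : F → F →L[ℝ] F →L[ℝ] ℝ) (y u v : F) : F :=
  (G y).inverse ((1 / 2 : ℝ) •
    (fderiv ℝ G y u v + fderiv ℝ G y v u - ((fderiv ℝ G y).flip u).flip v))

/-- The Bismut connection, determined by `G(∇^B_u v, w) = G(∇_u v, w) + H(u, v, w) / 2`. By
`HermitianCoord.bismut_metric`, `HermitianCoord.bismut_J` and `HermitianCoord.bismut_torsion` below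
it is Hermitian and its torsion is the three-form `H`. -/
def bismut (G : F → F →L[ℝ] F →L[ℝ] ℝ) (y u v : F) : F :=
  leviCivita G y u v + (G y).inverse ((1 / 2 : ℝ) • torsionForm G y u v)

/-- The curvature `R(u, v) w = ∇_u ∇_v w - ∇_v ∇_u w` of the connection with coefficients `Γ`
(constant coordinate fields commute). -/
def curvature (Γ : F → F → F → F) (y u v w : F) : F :=
  fderiv ℝ (fun y' ↦ Γ y' v w) y u - fderiv ℝ (fun y' ↦ Γ y' u w) y v
    + Γ y u (Γ y v w) - Γ y v (Γ y u w)

/-! The next facts justify the definition of the Bismut connection: for a Hermitian metric it is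
compatible with the metric and with `J`, and its torsion is the three-form `H`. -/

section Justification

variable {G : F → F →L[ℝ] F →L[ℝ] ℝ} {y : F}

theorem apply_inverse [FiniteDimensional ℂ F] (hpos : ∀ u, u ≠ 0 → 0 < G y u u) (l : F →L[ℝ] ℝ) :
    G y ((G y).inverse l) = l := by
  have : FiniteDimensional ℝ F := FiniteDimensional.complexToReal F
  have hinj : Function.Injective (G y) := by
    rw [injective_iff_map_eq_zero]
    intro u hu
    by_contra h
    have := hpos u h
    simp [hu] at this
  have hdim : Module.finrank ℝ F = Module.finrank ℝ (F →L[ℝ] ℝ) := by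
    rw [← LinearEquiv.finrank_eq (LinearMap.toContinuousLinearMap (𝕜 := ℝ) (E := F) (F' := ℝ))]
    exact (Subspace.dual_finrank_eq (K := ℝ) (V := F)).symm
  let e := (LinearEquiv.ofInjectiveOfFinrankEq (G y).toLinearMap hinj hdim).toContinuousLinearEquiv
  have he : G y = (e : F →L[ℝ] (F →L[ℝ] ℝ)) := by
    ext u v
    rfl
  rw [he, ContinuousLinearMap.inverse_equiv]
  exact e.apply_symm_apply l

theorem fderiv_symm (hG : DifferentiableAt ℝ G y) (hsymm : ∀ᶠ y' in 𝓝 y, ∀ u v, G y' u v = G y' v u)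
    (u v w : F) : fderiv ℝ G y u v w = fderiv ℝ G y u w v := by
  have key : ∀ v w, fderiv ℝ (fun y' ↦ G y' v w) y u = fderiv ℝ G y u v w := by
    intro v w
    have := ((hG.hasFDerivAt.clm_apply (hasFDerivAt_const v y)).clm_apply
      (hasFDerivAt_const w y)).fderiv
    rw [this]
    simp
  rw [← key, ← key, Filter.EventuallyEq.fderiv_eq]
  filter_upwards [hsymm] with y' h using h v w

theorem fderiv_compatible (hG : DifferentiableAt ℝ G y)
    (hJ : ∀ᶠ y' in 𝓝 y, ∀ u v, G y' (J u) (J v) = G y' u v)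
    (u v w : F) : fderiv ℝ G y u (J v) (J w) = fderiv ℝ G y u v w := by
  have key : ∀ v w, fderiv ℝ (fun y' ↦ G y' v w) y u = fderiv ℝ G y u v w := by
    intro v w
    have := ((hG.hasFDerivAt.clm_apply (hasFDerivAt_const v y)).clm_apply
      (hasFDerivAt_const w y)).fderiv
    rw [this]
    simp
  rw [← key, ← key, Filter.EventuallyEq.fderiv_eq]
  filter_upwards [hJ] with y' h using h v w

theorem J_J (u : F) : J (J u) = -u := by
  simp [J, smul_smul]

theorem torsionForm_apply (hG : DifferentiableAt ℝ G y) (u v w : F) :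
    torsionForm G y u v w = fderiv ℝ G y (J u) (J (J v)) (J w)
      - fderiv ℝ G y (J v) (J (J u)) (J w) + fderiv ℝ G y (J w) (J (J u)) (J v) := by
  have h : ∀ a b c, fderiv ℝ (fundamentalForm G) y a b c = fderiv ℝ G y a (J b) c := by
    intro a b c
    have := (hG.hasFDerivAt.clm_comp (hasFDerivAt_const (J : F →L[ℝ] F) y)).fderiv
    change fderiv ℝ (fun y' ↦ (G y').comp J) y a b c = _
    rw [this]
    simp
  simp [torsionForm, extDeriv₂, h]

/-- The defining relation of the Bismut connection. -/
theorem apply_bismut [FiniteDimensional ℂ F] (hpos : ∀ u, u ≠ 0 → 0 < G y u u) (u v w : F) :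
    G y (bismut G y u v) w = (1 / 2 : ℝ) * (fderiv ℝ G y u v w + fderiv ℝ G y v u w
      - fderiv ℝ G y w u v + torsionForm G y u v w) := by
  simp only [bismut, leviCivita, map_add, apply_inverse hpos]
  simp
  ring

/-- The Bismut connection is compatible with the metric. -/
theorem bismut_metric [FiniteDimensional ℂ F] (hG : DifferentiableAt ℝ G y)
    (hpos : ∀ u, u ≠ 0 → 0 < G y u u) (hsymm : ∀ᶠ y' in 𝓝 y, ∀ u v, G y' u v = G y' v u)
    (hJ : ∀ᶠ y' in 𝓝 y, ∀ u v, G y' (J u) (J v) = G y' u v) (u v w : F) :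
    fderiv ℝ G y u v w = G y (bismut G y u v) w + G y v (bismut G y u w) := by
  rw [hsymm.self_of_nhds v, apply_bismut hpos, apply_bismut hpos, torsionForm_apply hG,
    torsionForm_apply hG]
  have s := fderiv_symm hG hsymm
  have c := fderiv_compatible hG hJ
  simp only [J_J, map_neg, neg_apply]
  have h1 := c (J u) v (J w)
  have h2 := c (J u) (J v) w
  have h3 := c (J v) u (J w)
  have h4 := c (J w) u (J v)
  simp only [J_J, map_neg, neg_apply] at h1 h2 h3 h4
  linarith [s u v w, s u w v, s v u w, s w u v, s (J u) v (J w), s (J u) w (J v), s (J v) u (J w),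
    s (J w) u (J v), s (J v) w (J u), s (J w) v (J u)]

/-- The Bismut connection is compatible with the complex structure. -/
theorem bismut_J [FiniteDimensional ℂ F] (hG : DifferentiableAt ℝ G y)
    (hpos : ∀ u, u ≠ 0 → 0 < G y u u) (hsymm : ∀ᶠ y' in 𝓝 y, ∀ u v, G y' u v = G y' v u)
    (hJ : ∀ᶠ y' in 𝓝 y, ∀ u v, G y' (J u) (J v) = G y' u v) (u v : F) :
    bismut G y u (J v) = J (bismut G y u v) := by
  have key : ∀ w, G y (bismut G y u (J v)) w = G y (J (bismut G y u v)) w := by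
    intro w
    have h0 : G y (J (bismut G y u v)) w = - G y (bismut G y u v) (J w) := by
      have := hJ.self_of_nhds (bismut G y u v) (J w)
      rw [J_J, map_neg] at this
      linarith
    rw [h0, apply_bismut hpos, apply_bismut hpos, torsionForm_apply hG, torsionForm_apply hG]
    have s := fderiv_symm hG hsymm
    have c := fderiv_compatible hG hJ
    have c' : ∀ a b d, fderiv ℝ G y a b (J d) = - fderiv ℝ G y a (J b) d := by
      intro a b d
      have := c a (J b) d
      simp only [J_J, map_neg, neg_apply] at this
      linarith [c a b (J d)]
    simp only [J_J, map_neg, neg_apply, c']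
    linarith [s u v w, s (J v) u w, s w u v, s v u w, s (J w) u v, s u (J v) w, s w u (J v),
      s v u (J w), c' v u w, c' w u v, c' (J w) u v, c' (J v) u w, s u w (J v), c' u v w]
  by_contra hne
  have h1 := hpos _ (sub_ne_zero.2 hne)
  have h2 := key (bismut G y u (J v) - J (bismut G y u v))
  rw [map_sub (G y), sub_apply] at h1
  linarith

/-- The torsion of the Bismut connection is the three-form `H`. -/
theorem bismut_torsion [FiniteDimensional ℂ F] (hG : DifferentiableAt ℝ G y)
    (hpos : ∀ u, u ≠ 0 → 0 < G y u u) (hsymm : ∀ᶠ y' in 𝓝 y, ∀ u v, G y' u v = G y' v u)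
    (hJ : ∀ᶠ y' in 𝓝 y, ∀ u v, G y' (J u) (J v) = G y' u v) (u v w : F) :
    G y (bismut G y u v - bismut G y v u) w = torsionForm G y u v w := by
  rw [map_sub, sub_apply, apply_bismut hpos, apply_bismut hpos,
    torsionForm_apply hG, torsionForm_apply hG]
  have s := fderiv_symm hG hsymm
  have h1 := fderiv_compatible hG hJ (J w) u (J v)
  simp only [J_J, map_neg, neg_apply] at h1 ⊢
  linarith [s w u v, s (J w) u (J v), s (J w) v (J u)]

end Justification

end HermitianCoord

/-! ## Hermitian manifolds

A complex manifold is a charted space `M` over `F` with `IsManifold 𝓘(ℂ, F) ω M`. The tangent space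
at `x` is identified with `F` through the preferred holomorphic chart at `x`, and the complex
structure on it is multiplication by the imaginary unit. -/

/-- The underlying real model of a complex vector space. -/
abbrev realModel (F : Type*) [NormedAddCommGroup F] [NormedSpace ℂ F] : ModelWithCorners ℝ F F :=
  𝓘(ℝ, F)

section Manifold

variable {F : Type*} [NormedAddCommGroup F] [NormedSpace ℂ F]
  {M : Type*} [TopologicalSpace M] [ChartedSpace F M]

variable (F M) in
/-- A field of real bilinear forms on the tangent spaces. -/
abbrev BilinField : Type _ :=
  (x : M) → TangentSpace (realModel F) x →L[ℝ] TangentSpace (realModel F) x →L[ℝ] ℝ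

/-- The complex structure of the tangent space at `x`. -/
def tangentJ (x : M) : TangentSpace (realModel F) x →L[ℝ] TangentSpace (realModel F) x :=
  HermitianCoord.J (F := F)

/-- The coordinate expression of a field of bilinear forms in the preferred chart at `x`: its
pullback under the inverse of the chart. -/
def coordExpr (g : BilinField F M) (x : M) (y : F) : F →L[ℝ] F →L[ℝ] ℝ :=
  let D : F →L[ℝ] F := mfderiv (realModel F) (realModel F) (chartAt F x).symm y
  let b : F →L[ℝ] F →L[ℝ] ℝ := g ((chartAt F x).symm y)
  b.bilinearComp D D

/-- A smooth Hermitian metric. -/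
structure IsHermitianMetric (g : BilinField F M) : Prop where
  symm : ∀ x u v, g x u v = g x v u
  pos : ∀ x u, u ≠ 0 → 0 < g x u u
  compatible : ∀ x u v, g x (tangentJ x u) (tangentJ x v) = g x u v
  smooth : ∀ x, ContDiffOn ℝ ∞ (coordExpr g x) (chartAt F x).target

/-- The metric is Kähler: Hermitian with closed fundamental form. -/
structure IsKahlerMetric (g : BilinField F M) : Prop extends IsHermitianMetric g where
  closed : ∀ (x : M) (u v w : F), HermitianCoord.extDeriv₂
    (HermitianCoord.fundamentalForm (coordExpr g x)) (chartAt F x x) u v w = 0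

/-- The metric is SKT (pluriclosed): Hermitian with closed Bismut torsion form. -/
structure IsSKTMetric (h : BilinField F M) : Prop extends IsHermitianMetric h where
  closed : ∀ (x : M) (u v w z : F), HermitianCoord.extDeriv₃
    (fun y u v w ↦ HermitianCoord.torsionForm (coordExpr h x) y u v w) (chartAt F x x) u v w z = 0

/-- The Riemannian curvature tensor `R(u, v, w, z) = g(R(u, v) w, z)` at `x`. -/
def riemannCurvature (g : BilinField F M) (x : M) (u v w z : TangentSpace (realModel F) x) : ℝ :=
  g x (HermitianCoord.curvature (F := F) (HermitianCoord.leviCivita (coordExpr g x))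
    (chartAt F x x) u v w) z

/-- The Bismut curvature tensor `R^B(u, v, w, z) = g(R^B(u, v) w, z)` at `x`. -/
def bismutCurvature (g : BilinField F M) (x : M) (u v w z : TangentSpace (realModel F) x) : ℝ :=
  g x (HermitianCoord.curvature (F := F) (HermitianCoord.bismut (coordExpr g x))
    (chartAt F x x) u v w) z

/-- An orthonormal frame of the tangent space at `x`, indexed by the real dimension. -/
def IsOrthonormalFrame (g : BilinField F M) (x : M)
    (e : Fin (Module.finrank ℝ F) → TangentSpace (realModel F) x) : Prop :=
  ∀ i j, g x (e i) (e j) = if i = j then 1 else 0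

/-- The Ricci tensor `Ric(v, w) = ∑ i, R(e i, v, w, e i)` computed in a frame `e`. -/
def ricciTensor (g : BilinField F M) (x : M)
    (e : Fin (Module.finrank ℝ F) → TangentSpace (realModel F) x)
    (v w : TangentSpace (realModel F) x) : ℝ :=
  ∑ i, riemannCurvature g x (e i) v w (e i)

/-- The Bismut Ricci form `ρ^B(u, v) = (1/2) ∑ i, R^B(u, v, J (e i), e i)` computed in a
frame `e`. -/
def bismutRicciForm (g : BilinField F M) (x : M)
    (e : Fin (Module.finrank ℝ F) → TangentSpace (realModel F) x)
    (u v : TangentSpace (realModel F) x) : ℝ :=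
  (1 / 2 : ℝ) * ∑ i, bismutCurvature g x u v (tangentJ x (e i)) (e i)

/-- The Riemannian metric is Ricci-flat. -/
def IsRicciFlat (g : BilinField F M) : Prop :=
  ∀ x e, IsOrthonormalFrame g x e → ∀ v w, ricciTensor g x e v w = 0

/-- The Riemannian metric is flat. -/
def IsRiemannFlat (g : BilinField F M) : Prop :=
  ∀ x u v w z, riemannCurvature g x u v w z = 0

/-- The Hermitian metric is CYT (Calabi-Yau with torsion): its Bismut Ricci form vanishes. -/
def IsCYT (g : BilinField F M) : Prop :=
  ∀ x e, IsOrthonormalFrame g x e → ∀ u v, bismutRicciForm g x e u v = 0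

/-- The Bismut connection of the Hermitian metric is flat. -/
def IsBismutFlat (g : BilinField F M) : Prop :=
  ∀ x u v w z, bismutCurvature g x u v w z = 0

end Manifold

/-! ## Mapping tori -/

section MappingTorus

variable {X : Type*} [TopologicalSpace X]

/-- The product `X × ℝ`, tagged by a homeomorphism `f` of `X`. -/
def Suspension (_f : X ≃ₜ X) : Type _ := X × ℝ

instance (f : X ≃ₜ X) : TopologicalSpace (Suspension f) := inferInstanceAs (TopologicalSpace (X × ℝ))

/-- The action `n · (p, t) = (f ^ n p, t + n)` of `ℤ`. -/
instance (f : X ≃ₜ X) : AddAction ℤ (Suspension f) where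
  vadd n a := ((f ^ n) a.1, a.2 + n)
  zero_vadd a := by
    change (((f ^ (0 : ℤ)) a.1, a.2 + ((0 : ℤ) : ℝ)) : X × ℝ) = a
    simp only [zpow_zero, Homeomorph.one_apply, Int.cast_zero, add_zero]
    rfl
  add_vadd m n a := by
    change (((f ^ (m + n)) a.1, a.2 + ((m + n : ℤ) : ℝ)) : X × ℝ)
      = ((f ^ m) ((f ^ n) a.1), a.2 + (n : ℝ) + (m : ℝ))
    rw [zpow_add, Homeomorph.mul_apply]
    push_cast
    rw [add_assoc, add_comm (m : ℝ)]

/-- The mapping torus of `f`, the quotient of `X × ℝ` by the action of `ℤ`. -/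
def MappingTorus (f : X ≃ₜ X) : Type _ := AddAction.orbitRel.Quotient ℤ (Suspension f)

instance (f : X ≃ₜ X) : TopologicalSpace (MappingTorus f) :=
  inferInstanceAs (TopologicalSpace (AddAction.orbitRel.Quotient ℤ (Suspension f)))

/-- The quotient map `X × ℝ → M_f`. -/
def MappingTorus.mk (f : X ≃ₜ X) (a : X × ℝ) : MappingTorus f :=
  Quotient.mk (AddAction.orbitRel ℤ (Suspension f)) a

end MappingTorus

section MappingTorus

variable {X : Type*} [TopologicalSpace X]

instance (f : X ≃ₜ X) [T2Space X] : T2Space (Suspension f) := inferInstanceAs (T2Space (X × ℝ))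

instance (f : X ≃ₜ X) [LocallyCompactSpace X] : LocallyCompactSpace (Suspension f) :=
  inferInstanceAs (LocallyCompactSpace (X × ℝ))

instance (f : X ≃ₜ X) : ContinuousConstVAdd ℤ (Suspension f) where
  continuous_const_vadd n := by
    change Continuous (fun a : X × ℝ ↦ (((f ^ n) a.1, a.2 + n) : X × ℝ))
    fun_prop

instance (f : X ≃ₜ X) : IsCancelVAdd ℤ (Suspension f) where
  left_cancel' n a b h := by simpa using congrArg (fun c ↦ (-n) +ᵥ c) h
  right_cancel' m n a h := by
    have h' : a.2 + (m : ℝ) = a.2 + (n : ℝ) := congrArg (fun c : X × ℝ ↦ c.2) h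
    exact_mod_cast add_left_cancel h'

instance (f : X ≃ₜ X) : ProperlyDiscontinuousVAdd ℤ (Suspension f) where
  finite_disjoint_inter_image {C D} hC hD := by
    have hsnd : Continuous (fun a : Suspension f ↦ a.2) := continuous_snd (X := X) (Y := ℝ)
    obtain ⟨r, hr⟩ := (hC.image hsnd).isBounded.exists_norm_le
    obtain ⟨s, hs⟩ := (hD.image hsnd).isBounded.exists_norm_le
    refine (Set.finite_Icc (-⌈r + s⌉) ⌈r + s⌉).subset ?_
    rintro n ⟨_, ⟨a, ha, rfl⟩, hb⟩
    have h1 := abs_le.1 (hr _ ⟨a, ha, rfl⟩)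
    have h2 := abs_le.1 (hs _ ⟨_, hb, rfl⟩)
    change -s ≤ a.2 + (n : ℝ) ∧ a.2 + (n : ℝ) ≤ s at h2
    have h3 := Int.le_ceil (r + s)
    constructor
    · have : (-⌈r + s⌉ : ℝ) ≤ n := by linarith [h1.1, h1.2, h2.1, h2.2]
      exact_mod_cast this
    · have : (n : ℝ) ≤ ⌈r + s⌉ := by linarith [h1.1, h1.2, h2.1, h2.2]
      exact_mod_cast this

theorem MappingTorus.isLocalHomeomorph_mk (f : X ≃ₜ X) [T2Space X] [LocallyCompactSpace X] :
    IsLocalHomeomorph (MappingTorus.mk f) :=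
  (isAddQuotientCoveringMap_quotientMk_of_properlyDiscontinuousVAdd
    (G := ℤ) (E := Suspension f)).isCoveringMap.isLocalHomeomorph

end MappingTorus

/-! ## The mapping torus of `(ψ, id)` on `K × S³` -/

section KahlerTorus

/-- The complex plane `ℂ²` with its Euclidean norm. -/
abbrev C2 : Type := EuclideanSpace ℂ (Fin 2)

/-- The complement of the origin in `ℂ²`. -/
abbrev PuncturedC2 : TopologicalSpace.Opens C2 := ⟨{0}ᶜ, isOpen_compl_singleton⟩

/-- The unit sphere of `ℂ²`. -/
abbrev S3 : Type := Metric.sphere (0 : C2) 1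

variable {E : Type*} [NormedAddCommGroup E] [NormedSpace ℂ E]
  {K : Type*} [TopologicalSpace K]

/-- The product complex atlas on `K × (ℂ² ∖ 0)`. -/
instance productChartedSpace [ChartedSpace E K] : ChartedSpace (E × C2) (K × PuncturedC2) :=
  prodChartedSpace E K C2 PuncturedC2

/-- The product metric `g + g_E / R²` on `K × (ℂ² ∖ 0)`, where `R` is the Euclidean norm on `ℂ²`
and `g_E` the Euclidean metric. -/
def productMetric [ChartedSpace E K] (g : BilinField E K) :
    BilinField (E × C2) (K × PuncturedC2) := fun a ↦
  let gK : E →L[ℝ] E →L[ℝ] ℝ := g a.1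
  let gE : C2 →L[ℝ] C2 →L[ℝ] ℝ := innerSL ℝ
  let b : (E × C2) →L[ℝ] (E × C2) →L[ℝ] ℝ :=
    gK.bilinearComp (ContinuousLinearMap.fst ℝ E C2) (ContinuousLinearMap.fst ℝ E C2)
      + (‖(a.2 : C2)‖ ^ 2)⁻¹ •
        gE.bilinearComp (ContinuousLinearMap.snd ℝ E C2) (ContinuousLinearMap.snd ℝ E C2)
  b

/-- The mapping torus `M_f` of `f = (ψ, id)` on `K × S³`. -/
abbrev KahlerTorus (ψ : K ≃ₜ K) : Type _ := MappingTorus (ψ.prodCongr (Homeomorph.refl S3))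

/-- The homeomorphism `(p, x) ↦ (p, x / ‖x‖, log₂ ‖x‖)` from `K × (ℂ² ∖ 0)` to `K × S³ × ℝ`, with
inverse `(p, q, t) ↦ (p, 2 ^ t q)`. -/
def polarHomeomorph (K : Type*) [TopologicalSpace K] : K × PuncturedC2 ≃ₜ (K × S3) × ℝ where
  toFun a := ((a.1, ⟨(‖(a.2 : C2)‖⁻¹ : ℝ) • (a.2 : C2), by
    have : ‖(a.2 : C2)‖ ≠ 0 := norm_ne_zero_iff.2 a.2.2
    simp [norm_smul, this]⟩), Real.logb 2 ‖(a.2 : C2)‖)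
  invFun b := (b.1.1, ⟨((2 : ℝ) ^ b.2) • (b.1.2 : C2), by
    have h : ‖(b.1.2 : C2)‖ = 1 := by simp
    have h0 : (b.1.2 : C2) ≠ 0 := by
      intro h0
      simp [h0] at h
    exact smul_ne_zero (Real.rpow_pos_of_pos two_pos _).ne' h0⟩)
  left_inv a := by
    have h : 0 < ‖(a.2 : C2)‖ := norm_pos_iff.2 a.2.2
    refine Prod.ext rfl (Subtype.ext ?_)
    change (2 : ℝ) ^ Real.logb 2 ‖(a.2 : C2)‖ • (‖(a.2 : C2)‖⁻¹ • (a.2 : C2)) = a.2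
    rw [Real.rpow_logb two_pos (by norm_num) h, smul_smul, mul_inv_cancel₀ h.ne', one_smul]
  right_inv b := by
    have h : ‖(b.1.2 : C2)‖ = 1 := by simp
    have hn : ‖((2 : ℝ) ^ b.2) • (b.1.2 : C2)‖ = (2 : ℝ) ^ b.2 := by
      rw [norm_smul, h, mul_one, Real.norm_of_nonneg (Real.rpow_pos_of_pos two_pos _).le]
    refine Prod.ext (Prod.ext rfl (Subtype.ext ?_)) ?_
    · change ‖((2 : ℝ) ^ b.2) • (b.1.2 : C2)‖⁻¹ • (((2 : ℝ) ^ b.2) • (b.1.2 : C2)) = b.1.2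
      rw [hn, smul_smul, inv_mul_cancel₀ (Real.rpow_pos_of_pos two_pos _).ne', one_smul]
    · change Real.logb 2 ‖((2 : ℝ) ^ b.2) • (b.1.2 : C2)‖ = b.2
      rw [hn, Real.logb_rpow two_pos (by norm_num)]
  continuous_toFun := by
    have h : ∀ a : K × PuncturedC2, ‖(a.2 : C2)‖ ≠ 0 := fun a ↦ norm_ne_zero_iff.2 a.2.2
    have hc : Continuous fun a : K × PuncturedC2 ↦ (a.2 : C2) :=
      continuous_subtype_val.comp continuous_snd
    refine Continuous.prodMk (continuous_fst.prodMk (Continuous.subtype_mk ?_ _)) ?_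
    · exact (hc.norm.inv₀ h).smul hc
    · simp only [Real.logb]
      exact (hc.norm.log h).div_const _
  continuous_invFun := by
    refine Continuous.prodMk (by fun_prop) (Continuous.subtype_mk ?_ _)
    have h2 : Continuous fun b : (K × S3) × ℝ ↦ (2 : ℝ) ^ b.2 :=
      Real.continuous_const_rpow two_ne_zero |>.comp continuous_snd
    exact h2.smul (continuous_subtype_val.comp (continuous_snd.comp continuous_fst))

/-- The covering map `K × (ℂ² ∖ 0) → M_f`, `(p, x) ↦ [p, x / ‖x‖, log₂ ‖x‖]`. It identifies `M_f`
with the quotient of `K × (ℂ² ∖ 0)` by the action `n · (p, x) = (ψ ^ n p, 2 ^ n x)`. -/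
def torusCover (ψ : K ≃ₜ K) (a : K × PuncturedC2) : KahlerTorus ψ :=
  MappingTorus.mk _ (polarHomeomorph K a)

theorem torusCover_surjective (ψ : K ≃ₜ K) : Function.Surjective (torusCover ψ) :=
  Quotient.mk_surjective.comp (polarHomeomorph K).surjective

theorem torusCover_isLocalHomeomorph [CompactSpace K] [T2Space K] (ψ : K ≃ₜ K) :
    IsLocalHomeomorph (torusCover ψ) :=
  (MappingTorus.isLocalHomeomorph_mk _).comp (polarHomeomorph K).isLocalHomeomorph

/-- The complex atlas `I` of the mapping torus, pushed forward from the product complex structure by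
the covering map. -/
instance torusChartedSpace [ChartedSpace E K] [CompactSpace K] [T2Space K] (ψ : K ≃ₜ K) :
    ChartedSpace (E × C2) (KahlerTorus ψ) :=
  (torusCover_isLocalHomeomorph ψ).chartedSpace (torusCover_surjective ψ)

/-- The differential of the covering map at `a`. -/
def torusCoverDeriv [ChartedSpace E K] [CompactSpace K] [T2Space K] (ψ : K ≃ₜ K)
    (a : K × PuncturedC2) : TangentSpace (realModel (E × C2)) a →L[ℝ]
      TangentSpace (realModel (E × C2)) (torusCover ψ a) :=
  mfderiv (realModel (E × C2)) (realModel (E × C2)) (torusCover ψ) a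

/-- The metric `h` on the mapping torus induced by the product metric: at `m` it is the product
metric at a chosen preimage `a` of `m`, transported by the differential of the covering map. When
`ψ` is an isometry, it does not depend on the choice. -/
def torusMetric [ChartedSpace E K] [CompactSpace K] [T2Space K] (g : BilinField E K)
    (ψ : K ≃ₜ K) : BilinField (E × C2) (KahlerTorus ψ) := fun m ↦
  let a := Function.surjInv (torusCover_surjective ψ) m
  let D : (E × C2) →L[ℝ] (E × C2) := torusCoverDeriv (E := E) ψ a
  let b : (E × C2) →L[ℝ] (E × C2) →L[ℝ] ℝ := productMetric g a
  b.bilinearComp D.inverse D.inverse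

end KahlerTorus

/-! All assertions are local on the cover K × (ℂ² ∖ 0), where the geometry splits as a product and
so does the Bismut connection (`bismut_prodMetric`).

On the Kähler factor dω = 0, so H = 0 and the Bismut connection is the Levi-Civita connection
(`IsClosedOn.bismut_eq`). On ℂ² ∖ 0, identified with the nonzero quaternions, the fields y ↦ y·c
with c constant have constant length for g_E / R², and the frame they form is complex linear in c.
The flat connection making them parallel is therefore Hermitian, and its torsion is a three-form, so
it is the Bismut connection (`bismut_hopfMetric`, `curvatureCLM_hopfConnection`). Hence the Bismut
curvature of the product is the curvature of K plus zero (`curvature_bismut_hopf_product`), and it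
does not vanish because g is not flat.

SKT: H lives on the second factor only. There it is a constant multiple of R⁻⁴ times the contraction
of the volume form with the position vector, that is, of the volume form of S³ pulled back by x ↦ x
/ R, and so it is closed (`extDeriv₃_torsionForm_hopfMetric`).

CYT: twice ρ^B(u, v) is the trace of R^g(u, v) ∘ J on TK. By the first Bianchi identity and the
parallelism of J it is a difference of traces computing Ricci curvatures, which vanish
(`trace_curvatureCLM_comp_J`).

Descent: the deck transformations (ψ ^ n p, 2 ^ n x) are holomorphic isometries, the factor 4 ^ n of
g_E being absorbed by R². In each chart of M_f the metric h has exactly the product expression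
(`coordExpr_torusMetric`), so the local results apply at once. A chart of M_f singles out one
preimage of a point. An arbitrary preimage is compared with it by a deck transformation, using that
Riemannian curvature is invariant under isometries (`riemannCurvature_isometry`). -/

set_option maxSynthPendingDepth 3

/-! ### Connection coefficients and curvature as smooth operator-valued functions -/

namespace HermitianCoord

variable {F : Type*} [NormedAddCommGroup F] [NormedSpace ℂ F]

/-- `G` is a smooth Hermitian metric on the open subset `U` of `F`. -/
structure IsHermitianOn (G : F → F →L[ℝ] F →L[ℝ] ℝ) (U : Set F) : Prop where
  isOpen : IsOpen U
  smooth : ContDiffOn ℝ ∞ G U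
  symm : ∀ y ∈ U, ∀ u v, G y u v = G y v u
  pos : ∀ y ∈ U, ∀ u, u ≠ 0 → 0 < G y u u
  compatible : ∀ y ∈ U, ∀ u v, G y (J u) (J v) = G y u v

namespace IsHermitianOn

variable {G : F → F →L[ℝ] F →L[ℝ] ℝ} {U : Set F} {y : F}

theorem contDiffAt (h : IsHermitianOn G U) (hy : y ∈ U) : ContDiffAt ℝ ∞ G y :=
  h.smooth.contDiffAt (h.isOpen.mem_nhds hy)

theorem differentiableAt (h : IsHermitianOn G U) (hy : y ∈ U) : DifferentiableAt ℝ G y :=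
  (h.contDiffAt hy).differentiableAt (by simp)

theorem eventually_symm (h : IsHermitianOn G U) (hy : y ∈ U) :
    ∀ᶠ y' in 𝓝 y, ∀ u v, G y' u v = G y' v u :=
  Filter.eventually_of_mem (h.isOpen.mem_nhds hy) h.symm

theorem eventually_compatible (h : IsHermitianOn G U) (hy : y ∈ U) :
    ∀ᶠ y' in 𝓝 y, ∀ u v, G y' (J u) (J v) = G y' u v :=
  Filter.eventually_of_mem (h.isOpen.mem_nhds hy) h.compatible

theorem ext_apply (h : IsHermitianOn G U) (hy : y ∈ U) {a b : F} (hab : ∀ w, G y a w = G y b w) :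
    a = b := by
  by_contra hne
  have h1 := h.pos y hy _ (sub_ne_zero.2 hne)
  rw [map_sub (G y (a - b)), map_sub (G y), sub_apply, sub_apply, hab, hab] at h1
  simp at h1

theorem apply_leviCivita [FiniteDimensional ℂ F] (h : IsHermitianOn G U) (hy : y ∈ U) (u v w : F) :
    G y (leviCivita G y u v) w = (1 / 2 : ℝ) * (fderiv ℝ G y u v w + fderiv ℝ G y v u w
      - fderiv ℝ G y w u v) := by
  simp only [leviCivita, apply_inverse (h.pos y hy)]
  simp

end IsHermitianOn

/-- The coefficients of the Levi-Civita connection, as a field of bilinear maps. -/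
def christoffel (G : F → F →L[ℝ] F →L[ℝ] ℝ) (y : F) : F →L[ℝ] F →L[ℝ] F :=
  (ContinuousLinearMap.compL ℝ F (F →L[ℝ] ℝ) F (G y).inverse).comp ((1 / 2 : ℝ) •
    (fderiv ℝ G y + (fderiv ℝ G y).flip -
      ((ContinuousLinearMap.flipₗᵢ ℝ F F ℝ : (F →L[ℝ] F →L[ℝ] ℝ) →L[ℝ] (F →L[ℝ] F →L[ℝ] ℝ)).comp
        (fderiv ℝ G y).flip)))

theorem christoffel_apply (G : F → F →L[ℝ] F →L[ℝ] ℝ) (y u v : F) :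
    christoffel G y u v = leviCivita G y u v := by
  simp [christoffel, leviCivita]

/-- A positive form is injective into the dual, which has the same dimension. Invertibility is what
makes inversion smooth at the metric, hence the Christoffel symbols smooth. -/
theorem isInvertible_of_pos [FiniteDimensional ℂ F] {G : F →L[ℝ] F →L[ℝ] ℝ}
    (hpos : ∀ u, u ≠ 0 → 0 < G u u) : G.IsInvertible := by
  have : FiniteDimensional ℝ F := FiniteDimensional.complexToReal F
  have hinj : Function.Injective G := by
    rw [injective_iff_map_eq_zero]
    intro u hu
    by_contra h
    have := hpos u h
    simp [hu] at this
  have hdim : Module.finrank ℝ F = Module.finrank ℝ (F →L[ℝ] ℝ) := by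
    rw [← LinearEquiv.finrank_eq (LinearMap.toContinuousLinearMap (𝕜 := ℝ) (E := F) (F' := ℝ))]
    exact (Subspace.dual_finrank_eq (K := ℝ) (V := F)).symm
  refine ⟨(LinearEquiv.ofInjectiveOfFinrankEq G.toLinearMap hinj hdim).toContinuousLinearEquiv, ?_⟩
  ext u v
  rfl

theorem IsHermitianOn.contDiffAt_christoffel [FiniteDimensional ℂ F]
    {G : F → F →L[ℝ] F →L[ℝ] ℝ} {U : Set F} {y : F} (h : IsHermitianOn G U) (hy : y ∈ U) :
    ContDiffAt ℝ ∞ (christoffel G) y := by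
  have : CompleteSpace F := FiniteDimensional.complete ℂ F
  have hG := h.contDiffAt hy
  have hD : ContDiffAt ℝ ∞ (fderiv ℝ G) y := hG.fderiv_right (m := ∞) (by simp)
  have hinv : ContDiffAt ℝ ∞ (fun y ↦ (G y).inverse) y :=
    (isInvertible_of_pos (h.pos y hy)).contDiffAt_map_inverse.comp y hG
  have hflip : ContDiffAt ℝ ∞ (fun y ↦ (fderiv ℝ G y).flip) y :=
    (ContinuousLinearMap.flipₗᵢ ℝ F F (F →L[ℝ] ℝ)).contDiff.contDiffAt.comp y hD
  refine ContDiffAt.clm_comp ?_ (ContDiffAt.const_smul _ ((hD.add hflip).sub ?_))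
  · exact (ContinuousLinearMap.compL ℝ F (F →L[ℝ] ℝ) F).contDiff.contDiffAt.comp y hinv
  · exact contDiffAt_const.clm_comp hflip

/-- The curvature of a connection with coefficients `Γ`, as an endomorphism. -/
def curvatureCLM (Γ : F → F →L[ℝ] F →L[ℝ] F) (y u v : F) : F →L[ℝ] F :=
  fderiv ℝ Γ y u v - fderiv ℝ Γ y v u + (Γ y u).comp (Γ y v) - (Γ y v).comp (Γ y u)

theorem fderiv_apply₂ {V W X Z : Type*} [NormedAddCommGroup V] [NormedSpace ℝ V]
    [NormedAddCommGroup W] [NormedSpace ℝ W] [NormedAddCommGroup X] [NormedSpace ℝ X]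
    [NormedAddCommGroup Z] [NormedSpace ℝ Z] {A : V → W →L[ℝ] X →L[ℝ] Z} {y : V}
    (hA : DifferentiableAt ℝ A y) (u : V) (v : W) (w : X) :
    fderiv ℝ (fun y' ↦ A y' v w) y u = fderiv ℝ A y u v w := by
  have := ((hA.hasFDerivAt.clm_apply (hasFDerivAt_const v y)).clm_apply
    (hasFDerivAt_const w y)).fderiv
  rw [this]
  simp

/-- Passes from coefficients given as a bare function to bundled bilinear maps, on which the product
and chain rules apply. Agreement near `y` is required because the curvature involves a derivative of
the coefficients. -/
theorem curvature_eq {Γ₀ : F → F → F → F} {Γ : F → F →L[ℝ] F →L[ℝ] F} {y : F}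
    (h : ∀ᶠ y' in 𝓝 y, ∀ u v, Γ₀ y' u v = Γ y' u v) (hd : DifferentiableAt ℝ Γ y) (u v w : F) :
    curvature Γ₀ y u v w = curvatureCLM Γ y u v w := by
  have key : ∀ u v w, fderiv ℝ (fun y' ↦ Γ₀ y' v w) y u = fderiv ℝ Γ y u v w := by
    intro u v w
    rw [← fderiv_apply₂ hd, Filter.EventuallyEq.fderiv_eq]
    filter_upwards [h] with y' h using h v w
  simp [curvature, curvatureCLM, key, h.self_of_nhds]

/-! ### Naturality of curvature and exterior derivative -/

section Naturality

/-- `φ` is a smooth isometry from `(V, G)` to `(U', G')`. -/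
structure IsLocalIsometryOn (G G' : F → F →L[ℝ] F →L[ℝ] ℝ) (V U' : Set F) (φ : F → F) : Prop where
  isOpen : IsOpen V
  smooth : ContDiffOn ℝ ∞ φ V
  mapsTo : Set.MapsTo φ V U'
  pullback : ∀ y ∈ V, ∀ u v, G y u v = G' (φ y) (fderiv ℝ φ y u) (fderiv ℝ φ y v)

variable {G G' : F → F →L[ℝ] F →L[ℝ] ℝ} {U V U' : Set F} {φ : F → F} {y : F}

theorem IsLocalIsometryOn.contDiffAt (hφ : IsLocalIsometryOn G G' V U' φ) (hy : y ∈ V) :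
    ContDiffAt ℝ ∞ φ y :=
  hφ.smooth.contDiffAt (hφ.isOpen.mem_nhds hy)

/-- Preserving a positive form forces injectivity, and source and target have equal dimension.
Surjectivity allows identities at `φ y` to be tested on vectors of the form dφ(w). -/
theorem IsLocalIsometryOn.surjective_fderiv [FiniteDimensional ℂ F]
    (hφ : IsLocalIsometryOn G G' V U' φ)
    (hG : IsHermitianOn G U) (hVU : V ⊆ U) (hy : y ∈ V) :
    Function.Surjective (fderiv ℝ φ y) := by
  have : FiniteDimensional ℝ F := FiniteDimensional.complexToReal F
  refine (LinearMap.injective_iff_surjective (f := (fderiv ℝ φ y).toLinearMap)).1 ?_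
  rw [injective_iff_map_eq_zero]
  intro u hu
  by_contra h
  have h1 := hG.pos y (hVU hy) u h
  have hu' : fderiv ℝ φ y u = 0 := hu
  rw [hφ.pullback y hy, hu'] at h1
  simp at h1

/-- The derivative of the pullback of a field of bilinear forms. -/
theorem fderiv_pullback {V : Set F} (hV : IsOpen V) (hsm : ContDiffOn ℝ ∞ φ V) (hy : y ∈ V)
    {A A' : F → F →L[ℝ] F →L[ℝ] ℝ} (hA : DifferentiableAt ℝ A y)
    (hA' : DifferentiableAt ℝ A' (φ y))
    (hpull : ∀ y ∈ V, ∀ u v, A y u v = A' (φ y) (fderiv ℝ φ y u) (fderiv ℝ φ y v)) (w u v : F) :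
    fderiv ℝ A y w u v = fderiv ℝ A' (φ y) (fderiv ℝ φ y w) (fderiv ℝ φ y u) (fderiv ℝ φ y v)
      + A' (φ y) (fderiv ℝ (fderiv ℝ φ) y w u) (fderiv ℝ φ y v)
      + A' (φ y) (fderiv ℝ φ y u) (fderiv ℝ (fderiv ℝ φ) y w v) := by
  have hφ : ContDiffAt ℝ ∞ φ y := hsm.contDiffAt (hV.mem_nhds hy)
  have hD : DifferentiableAt ℝ (fderiv ℝ φ) y :=
    (hφ.fderiv_right (m := ∞) (by simp)).differentiableAt (by simp)
  have h1 := hA'.hasFDerivAt.comp y (hφ.differentiableAt (by simp)).hasFDerivAt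
  have h2 : ∀ u, HasFDerivAt (fun y ↦ fderiv ℝ φ y u) ((fderiv ℝ (fderiv ℝ φ) y).flip u) y := by
    intro u
    have := hD.hasFDerivAt.clm_apply (hasFDerivAt_const u y)
    convert this using 1
    ext; simp
  have h3 := ((h1.clm_apply (h2 u)).clm_apply (h2 v)).fderiv
  have h4 : fderiv ℝ (fun y ↦ A y u v) y = fderiv ℝ (fun y ↦ A' (φ y) (fderiv ℝ φ y u)
      (fderiv ℝ φ y v)) y := by
    refine Filter.EventuallyEq.fderiv_eq ?_
    filter_upwards [hV.mem_nhds hy] with y' hy' using hpull y' hy' u v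
  rw [← fderiv_apply₂ hA, h4]
  refine (congrArg (fun L ↦ L w) h3).trans ?_
  simp
  ring

theorem two_le_infty : (2 : WithTop ℕ∞) ≤ ∞ := by
  exact ENat.LEInfty.out

theorem fderiv_fderiv_symm (hφ : ContDiffAt ℝ ∞ φ y) (u v : F) :
    fderiv ℝ (fderiv ℝ φ) y u v = fderiv ℝ (fderiv ℝ φ) y v u :=
  (hφ.isSymmSndFDerivAt (by simpa using two_le_infty)) u v

/-- The transformation law of the Christoffel symbols under a local isometry. -/
theorem IsLocalIsometryOn.christoffel [FiniteDimensional ℂ F]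
    (hφ : IsLocalIsometryOn G G' V U' φ)
    (hG : IsHermitianOn G U) (hVU : V ⊆ U) (hG' : IsHermitianOn G' U') (hy : y ∈ V) (u v : F) :
    fderiv ℝ φ y (christoffel G y u v) = HermitianCoord.christoffel G' (φ y) (fderiv ℝ φ y u)
      (fderiv ℝ φ y v) + fderiv ℝ (fderiv ℝ φ) y u v := by
  refine hG'.ext_apply (hφ.mapsTo hy) fun w' ↦ ?_
  obtain ⟨w, rfl⟩ := hφ.surjective_fderiv hG hVU hy w'
  rw [← hφ.pullback y hy, map_add, add_apply, christoffel_apply, christoffel_apply,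
    hG.apply_leviCivita (hVU hy), hG'.apply_leviCivita (hφ.mapsTo hy)]
  have key := fderiv_pullback hφ.isOpen hφ.smooth hy (hG.differentiableAt (hVU hy))
    (hG'.differentiableAt (hφ.mapsTo hy)) hφ.pullback
  have hs := fderiv_fderiv_symm (hφ.contDiffAt hy)
  have hs' := hG'.symm _ (hφ.mapsTo hy)
  -- In the Koszul combination the second derivatives of `φ` cancel in pairs, by symmetry of D²φ and
  -- of the metric, except the two terms G'(D²φ(u, v), dφ w).
  rw [key, key, key, hs v u, hs w u, hs w v, hs' (fderiv ℝ φ y v) (fderiv ℝ (fderiv ℝ φ) y u w),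
    hs' (fderiv ℝ φ y u) (fderiv ℝ (fderiv ℝ φ) y v w)]
  ring

/-- The Riemannian curvature is natural under local isometries. -/
theorem IsLocalIsometryOn.curvature [FiniteDimensional ℂ F]
    (hφ : IsLocalIsometryOn G G' V U' φ)
    (hG : IsHermitianOn G U) (hVU : V ⊆ U) (hG' : IsHermitianOn G' U') (hy : y ∈ V) (u v w : F) :
    fderiv ℝ φ y (curvatureCLM (HermitianCoord.christoffel G) y u v w)
      = curvatureCLM (HermitianCoord.christoffel G') (φ y) (fderiv ℝ φ y u) (fderiv ℝ φ y v)
          (fderiv ℝ φ y w) := by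
  have hsm := hφ.contDiffAt hy
  have hD1 : ContDiffAt ℝ ∞ (fderiv ℝ φ) y := hsm.fderiv_right (m := ∞) (by simp)
  have hD2 : ContDiffAt ℝ ∞ (fderiv ℝ (fderiv ℝ φ)) y := hD1.fderiv_right (m := ∞) (by simp)
  have hD1' := (hD1.differentiableAt (by simp)).hasFDerivAt
  have hD2' := (hD2.differentiableAt (by simp)).hasFDerivAt
  have hΓ := ((hG.contDiffAt_christoffel (hVU hy)).differentiableAt (by simp)).hasFDerivAt
  have hΓ' := ((hG'.contDiffAt_christoffel (hφ.mapsTo hy)).differentiableAt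
    (by simp)).hasFDerivAt.comp y (hsm.differentiableAt (by simp)).hasFDerivAt
  have hrel := fun z (hz : z ∈ V) ↦ hφ.christoffel hG hVU hG' hz
  have h2 : ∀ u, HasFDerivAt (fun y ↦ fderiv ℝ φ y u) ((fderiv ℝ (fderiv ℝ φ) y).flip u) y := by
    intro u
    convert hD1'.clm_apply (hasFDerivAt_const u y) using 1
    ext; simp
  -- The transformation law of the Christoffel symbols differentiated in the direction `u`. After
  -- skew-symmetrization in `u`, `v` the D³φ term and the term with D²φ(u, v) drop out; the other
  -- D²φ terms cancel against those produced by the quadratic part of the curvature.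
  have hder : ∀ u v w, fderiv ℝ φ y (fderiv ℝ (HermitianCoord.christoffel G) y u v w)
      + fderiv ℝ (fderiv ℝ φ) y u (HermitianCoord.christoffel G y v w)
      = fderiv ℝ (HermitianCoord.christoffel G') (φ y) (fderiv ℝ φ y u) (fderiv ℝ φ y v)
          (fderiv ℝ φ y w)
        + HermitianCoord.christoffel G' (φ y) (fderiv ℝ (fderiv ℝ φ) y u v) (fderiv ℝ φ y w)
        + HermitianCoord.christoffel G' (φ y) (fderiv ℝ φ y v) (fderiv ℝ (fderiv ℝ φ) y u w)
        + fderiv ℝ (fderiv ℝ (fderiv ℝ φ)) y u v w := by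
    intro u v w
    have e1 := hD1'.clm_apply
      ((hΓ.clm_apply (hasFDerivAt_const v y)).clm_apply (hasFDerivAt_const w y))
    have e2 := ((hΓ'.clm_apply (h2 v)).clm_apply (h2 w)).add
      ((hD2'.clm_apply (hasFDerivAt_const v y)).clm_apply (hasFDerivAt_const w y))
    have e3 := e1.unique (e2.congr_of_eventuallyEq (by
      filter_upwards [hφ.isOpen.mem_nhds hy] with z hz using hrel z hz v w))
    have e4 := congrArg (fun L ↦ L u) e3
    simp at e4
    rw [e4]
    abel
  have hs3 : ∀ u v w, fderiv ℝ (fderiv ℝ (fderiv ℝ φ)) y u v w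
      = fderiv ℝ (fderiv ℝ (fderiv ℝ φ)) y v u w := by
    intro u v w
    rw [(hD1.isSymmSndFDerivAt (by simpa using two_le_infty)) u v]
  have hs2 := fderiv_fderiv_symm hsm
  have d1 := hder u v w
  have d2 := hder v u w
  rw [hs3 v u w, hs2 v u] at d2
  simp only [curvatureCLM, add_apply, sub_apply, ContinuousLinearMap.comp_apply, map_add, map_sub,
    hrel y hy]
  rw [eq_sub_of_add_eq d1, eq_sub_of_add_eq d2]
  abel

/-- The exterior derivative of two-forms is natural under pullback. -/
theorem extDeriv₂_pullback (hV : IsOpen V) (hsm : ContDiffOn ℝ ∞ φ V) (hy : y ∈ V)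
    {A A' : F → F →L[ℝ] F →L[ℝ] ℝ} (hA : DifferentiableAt ℝ A y)
    (hA' : DifferentiableAt ℝ A' (φ y)) (hskew : ∀ u v, A' (φ y) u v = - A' (φ y) v u)
    (hpull : ∀ y ∈ V, ∀ u v, A y u v = A' (φ y) (fderiv ℝ φ y u) (fderiv ℝ φ y v)) (u v w : F) :
    extDeriv₂ A y u v w
      = extDeriv₂ A' (φ y) (fderiv ℝ φ y u) (fderiv ℝ φ y v) (fderiv ℝ φ y w) := by
  have key := fderiv_pullback hV hsm hy hA hA' hpull
  have hs := fderiv_fderiv_symm (hsm.contDiffAt (hV.mem_nhds hy))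
  simp only [extDeriv₂, add_apply, sub_apply, ContinuousLinearMap.flip_apply]
  -- Here the form is skew while D²φ is symmetric, so every second derivative term cancels.
  rw [key, key, key, hs v u, hs w u, hs w v, hskew (fderiv ℝ φ y v) (fderiv ℝ (fderiv ℝ φ) y u w),
    hskew (fderiv ℝ φ y u) (fderiv ℝ (fderiv ℝ φ) y v w)]
  ring

end Naturality

end HermitianCoord

/-! ### Orthonormal frames and traces -/

section OrthonormalFrame

variable {V : Type*} [AddCommGroup V] [Module ℝ V] [FiniteDimensional ℝ V]

/-- In the basis `e` the coordinates of x are B(x, e j), so the sum runs over the diagonal of the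
matrix of `A`. This makes both Ricci contractions independent of the frame. -/
theorem sum_orthonormal_eq_trace {B : V →ₗ[ℝ] V →ₗ[ℝ] ℝ} {e : Fin (Module.finrank ℝ V) → V}
    (he : ∀ i j, B (e i) (e j) = if i = j then 1 else 0) (A : V →ₗ[ℝ] V) :
    ∑ i, B (A (e i)) (e i) = LinearMap.trace ℝ V A := by
  have hli : LinearIndependent ℝ e := by
    rw [Fintype.linearIndependent_iff]
    intro c hc j
    have := congrArg (fun x ↦ B x (e j)) hc
    simpa [he] using this
  let b : Module.Basis (Fin (Module.finrank ℝ V)) ℝ V :=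
    Module.Basis.mk hli (hli.span_eq_top_of_card_eq_finrank' (by simp)).ge
  have hb : ∀ i, b i = e i := fun i ↦ by simp [b]
  have hrepr : ∀ x j, b.repr x j = B x (e j) := by
    intro x j
    have h := congrArg (fun x ↦ B x (e j)) (b.sum_repr x)
    simpa [hb, he] using h
  rw [LinearMap.trace_eq_matrix_trace ℝ b, Matrix.trace]
  refine Finset.sum_congr rfl fun i _ ↦ ?_
  rw [Matrix.diag_apply, LinearMap.toMatrix_apply, hrepr, hb]

/-- Ricci-flatness is a statement about all orthonormal frames; it has content at a point only
because one exists. -/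
theorem exists_orthonormal_frame {B : V →ₗ[ℝ] V →ₗ[ℝ] ℝ} (hsymm : ∀ u v, B u v = B v u)
    (hpos : ∀ u, u ≠ 0 → 0 < B u u) :
    ∃ e : Fin (Module.finrank ℝ V) → V, ∀ i j, B (e i) (e j) = if i = j then 1 else 0 := by
  obtain ⟨b, hb⟩ := LinearMap.BilinForm.exists_orthogonal_basis (B := B) ⟨hsymm⟩
  have hp : ∀ i, 0 < B (b i) (b i) := fun i ↦ hpos _ (b.ne_zero i)
  refine ⟨fun i ↦ (√(B (b i) (b i)))⁻¹ • b i, fun i j ↦ ?_⟩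
  by_cases hij : i = j
  · subst hij
    have h1 : √(B (b i) (b i)) ≠ 0 := (Real.sqrt_pos.2 (hp i)).ne'
    have h2 := Real.mul_self_sqrt (hp i).le
    simp only [map_smul, LinearMap.smul_apply, smul_eq_mul, if_true]
    field_simp
    nlinarith
  · have : B (b i) (b j) = 0 := hb hij
    simp [this, hij]

end OrthonormalFrame

/-! ### Ricci-flat Kähler metrics: the complex trace of the curvature -/

namespace HermitianCoord

variable {F : Type*} [NormedAddCommGroup F] [NormedSpace ℂ F]
  {G : F → F →L[ℝ] F →L[ℝ] ℝ} {U : Set F} {y : F}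

/-- The endomorphism `z ↦ R(z, v) w` whose trace is the Ricci tensor. -/
def ricciEnd (Γ : F → F →L[ℝ] F →L[ℝ] F) (y v w : F) : F →L[ℝ] F :=
  ((fderiv ℝ Γ y).flip v).flip w - (fderiv ℝ Γ y v).flip w + (Γ y).flip (Γ y v w)
    - (Γ y v).comp ((Γ y).flip w)

theorem ricciEnd_apply (Γ : F → F →L[ℝ] F →L[ℝ] F) (y z v w : F) :
    ricciEnd Γ y v w z = curvatureCLM Γ y z v w := by
  simp [ricciEnd, curvatureCLM]

theorem curvatureCLM_bianchi {Γ : F → F →L[ℝ] F →L[ℝ] F} (hd : DifferentiableAt ℝ Γ y)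
    (hsymm : ∀ᶠ y' in 𝓝 y, ∀ u v, Γ y' u v = Γ y' v u) (u v w : F) :
    curvatureCLM Γ y u v w + curvatureCLM Γ y v w u + curvatureCLM Γ y w u v = 0 := by
  have h : ∀ u v w, fderiv ℝ Γ y u v w = fderiv ℝ Γ y u w v := by
    intro u v w
    rw [← fderiv_apply₂ hd, ← fderiv_apply₂ hd, Filter.EventuallyEq.fderiv_eq]
    filter_upwards [hsymm] with y' h using h v w
  have h0 := hsymm.self_of_nhds
  simp only [curvatureCLM, add_apply, sub_apply, ContinuousLinearMap.comp_apply]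
  rw [h u v w, h v u w, h w v u, h0 v w, h0 u w, h0 v u]
  abel

/-- J has constant coefficients, so commuting with J passes from the connection coefficients to
their derivatives. -/
theorem curvatureCLM_J {Γ : F → F →L[ℝ] F →L[ℝ] F} (hd : DifferentiableAt ℝ Γ y)
    (hJ : ∀ᶠ y' in 𝓝 y, ∀ u v, Γ y' u (J v) = J (Γ y' u v)) (u v w : F) :
    curvatureCLM Γ y u v (J w) = J (curvatureCLM Γ y u v w) := by
  have h : ∀ u v w, fderiv ℝ Γ y u v (J w) = J (fderiv ℝ Γ y u v w) := by
    intro u v w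
    have h1 : HasFDerivAt (fun y' ↦ Γ y' v w) (((fderiv ℝ Γ y).flip v).flip w) y := by
      convert (hd.hasFDerivAt.clm_apply (hasFDerivAt_const v y)).clm_apply
        (hasFDerivAt_const w y) using 1
      ext; simp
    have h2 := ((J (F := F)).hasFDerivAt.comp y h1).fderiv
    rw [← fderiv_apply₂ hd]
    have h3 : fderiv ℝ (fun y' ↦ Γ y' v (J w)) y = fderiv ℝ (J ∘ fun y' ↦ Γ y' v w) y := by
      refine Filter.EventuallyEq.fderiv_eq ?_
      filter_upwards [hJ] with y' h using h v w
    rw [h3, h2]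
    simp
  have h0 := hJ.self_of_nhds
  simp [curvatureCLM, h, h0]

/-- If a torsion free complex connection has vanishing Ricci tensor, then its curvature
endomorphisms have vanishing complex trace. -/
theorem trace_curvatureCLM_comp_J {Γ : F → F →L[ℝ] F →L[ℝ] F}
    (hd : DifferentiableAt ℝ Γ y) (hsymm : ∀ᶠ y' in 𝓝 y, ∀ u v, Γ y' u v = Γ y' v u)
    (hJ : ∀ᶠ y' in 𝓝 y, ∀ u v, Γ y' u (J v) = J (Γ y' u v))
    (hRic : ∀ v w, LinearMap.trace ℝ F (ricciEnd Γ y v w).toLinearMap = 0) (u v : F) :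
    LinearMap.trace ℝ F ((curvatureCLM Γ y u v).comp J).toLinearMap = 0 := by
  have hskew : ∀ u v w, curvatureCLM Γ y u v w = - curvatureCLM Γ y v u w := by
    intro u v w
    simp only [curvatureCLM, add_apply, sub_apply, ContinuousLinearMap.comp_apply]
    abel
  -- By cyclicity the trace is that of z ↦ J R(z, v) u = R(z, v)(J u), a Ricci trace.
  have h1 : ∀ u v, LinearMap.trace ℝ F
      ((ricciEnd Γ y v u).toLinearMap * (J (F := F)).toLinearMap) = 0 := by
    intro u v
    rw [LinearMap.trace_mul_comm, ← hRic v (J u)]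
    congr 1
    ext w
    simp [ricciEnd_apply, curvatureCLM_J hd hJ]
  -- Bianchi for u, v, Jw: R(u, v) Jw = R(Jw, v) u - R(Jw, u) v.
  have h2 : ((curvatureCLM Γ y u v).comp J).toLinearMap
      = (ricciEnd Γ y v u).toLinearMap * (J (F := F)).toLinearMap
        - (ricciEnd Γ y u v).toLinearMap * (J (F := F)).toLinearMap := by
    ext w
    have := curvatureCLM_bianchi hd hsymm u v (J w)
    simp only [ContinuousLinearMap.coe_coe, ContinuousLinearMap.comp_apply, LinearMap.sub_apply,
      Module.End.mul_apply, ricciEnd_apply]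
    rw [hskew v (J w)] at this
    rw [← sub_eq_zero, ← this]
    abel
  rw [h2, map_sub, h1, h1, sub_zero]

/-- The fundamental form is closed on `U`. -/
def IsClosedOn (G : F → F →L[ℝ] F →L[ℝ] ℝ) (U : Set F) : Prop :=
  ∀ y ∈ U, ∀ u v w, extDeriv₂ (fundamentalForm G) y u v w = 0

theorem IsClosedOn.torsionForm_eq_zero (h : IsClosedOn G U) (hy : y ∈ U) (u v : F) :
    torsionForm G y u v = 0 := by
  ext w
  simp [torsionForm, h y hy]

theorem IsClosedOn.bismut_eq (h : IsClosedOn G U) (hy : y ∈ U) (u v : F) :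
    bismut G y u v = christoffel G y u v := by
  simp [bismut, h.torsionForm_eq_zero hy, christoffel_apply]

theorem IsHermitianOn.christoffel_symm [FiniteDimensional ℂ F] (hG : IsHermitianOn G U)
    (hy : y ∈ U) (u v : F) : christoffel G y u v = christoffel G y v u := by
  refine hG.ext_apply hy fun w ↦ ?_
  rw [christoffel_apply, christoffel_apply, hG.apply_leviCivita hy, hG.apply_leviCivita hy,
    fderiv_symm (hG.differentiableAt hy) (hG.eventually_symm hy) w u v]
  ring

/-- Levi-Civita agrees with Bismut when the fundamental form is closed, and the Bismut connection
always commutes with J. -/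
theorem IsHermitianOn.christoffel_J [FiniteDimensional ℂ F] (hG : IsHermitianOn G U)
    (hc : IsClosedOn G U) (hy : y ∈ U) (u v : F) :
    christoffel G y u (J v) = J (christoffel G y u v) := by
  rw [← hc.bismut_eq hy, ← hc.bismut_eq hy, bismut_J (hG.differentiableAt hy) (hG.pos y hy)
    (hG.eventually_symm hy) (hG.eventually_compatible hy)]

theorem IsHermitianOn.trace_curvatureCLM_comp_J [FiniteDimensional ℂ F] (hG : IsHermitianOn G U)
    (hc : IsClosedOn G U) (hy : y ∈ U)
    (hRic : ∀ v w, LinearMap.trace ℝ F (ricciEnd (christoffel G) y v w).toLinearMap = 0) (u v : F) :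
    LinearMap.trace ℝ F ((curvatureCLM (christoffel G) y u v).comp J).toLinearMap = 0 :=
  HermitianCoord.trace_curvatureCLM_comp_J
    ((hG.contDiffAt_christoffel hy).differentiableAt (by simp))
    (Filter.eventually_of_mem (hG.isOpen.mem_nhds hy) fun _ h ↦ hG.christoffel_symm h)
    (Filter.eventually_of_mem (hG.isOpen.mem_nhds hy) fun _ h ↦ hG.christoffel_J hc h) hRic u v

end HermitianCoord

/-! ### Products of Hermitian metrics -/

namespace HermitianCoord

section Product

variable {F₁ : Type*} [NormedAddCommGroup F₁] [NormedSpace ℂ F₁]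
  {F₂ : Type*} [NormedAddCommGroup F₂] [NormedSpace ℂ F₂]

/-- The orthogonal sum of two bilinear forms. -/
def prodForm (B₁ : F₁ →L[ℝ] F₁ →L[ℝ] ℝ) (B₂ : F₂ →L[ℝ] F₂ →L[ℝ] ℝ) :
    (F₁ × F₂) →L[ℝ] (F₁ × F₂) →L[ℝ] ℝ :=
  B₁.bilinearComp (ContinuousLinearMap.fst ℝ F₁ F₂) (ContinuousLinearMap.fst ℝ F₁ F₂)
    + B₂.bilinearComp (ContinuousLinearMap.snd ℝ F₁ F₂) (ContinuousLinearMap.snd ℝ F₁ F₂)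

@[simp]
theorem prodForm_apply (B₁ : F₁ →L[ℝ] F₁ →L[ℝ] ℝ) (B₂ : F₂ →L[ℝ] F₂ →L[ℝ] ℝ) (u v : F₁ × F₂) :
    prodForm B₁ B₂ u v = B₁ u.1 v.1 + B₂ u.2 v.2 := by
  simp [prodForm]

variable (F₁ F₂) in
/-- The pullback of bilinear forms along the first projection, as a continuous linear map. -/
def fstPull : (F₁ →L[ℝ] F₁ →L[ℝ] ℝ) →L[ℝ] ((F₁ × F₂) →L[ℝ] (F₁ × F₂) →L[ℝ] ℝ) :=
  ((ContinuousLinearMap.compL ℝ (F₁ × F₂) F₁ ((F₁ × F₂) →L[ℝ] ℝ)).flip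
    (ContinuousLinearMap.fst ℝ F₁ F₂)).comp
    (ContinuousLinearMap.compL ℝ F₁ (F₁ →L[ℝ] ℝ) ((F₁ × F₂) →L[ℝ] ℝ)
      ((ContinuousLinearMap.compL ℝ (F₁ × F₂) F₁ ℝ).flip (ContinuousLinearMap.fst ℝ F₁ F₂)))

variable (F₁ F₂) in
/-- The pullback of bilinear forms along the second projection, as a continuous linear map. -/
def sndPull : (F₂ →L[ℝ] F₂ →L[ℝ] ℝ) →L[ℝ] ((F₁ × F₂) →L[ℝ] (F₁ × F₂) →L[ℝ] ℝ) :=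
  ((ContinuousLinearMap.compL ℝ (F₁ × F₂) F₂ ((F₁ × F₂) →L[ℝ] ℝ)).flip
    (ContinuousLinearMap.snd ℝ F₁ F₂)).comp
    (ContinuousLinearMap.compL ℝ F₂ (F₂ →L[ℝ] ℝ) ((F₁ × F₂) →L[ℝ] ℝ)
      ((ContinuousLinearMap.compL ℝ (F₁ × F₂) F₂ ℝ).flip (ContinuousLinearMap.snd ℝ F₁ F₂)))

/-- Written with fixed continuous linear maps, the product metric can be differentiated by the chain
rule. -/
theorem prodForm_eq (B₁ : F₁ →L[ℝ] F₁ →L[ℝ] ℝ) (B₂ : F₂ →L[ℝ] F₂ →L[ℝ] ℝ) :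
    prodForm B₁ B₂ = fstPull F₁ F₂ B₁ + sndPull F₁ F₂ B₂ := by
  ext <;> simp [fstPull, sndPull]

@[simp]
theorem J_fst (u : F₁ × F₂) : (J u).1 = J u.1 := rfl

@[simp]
theorem J_snd (u : F₁ × F₂) : (J u).2 = J u.2 := rfl

variable {G₁ : F₁ → F₁ →L[ℝ] F₁ →L[ℝ] ℝ} {G₂ : F₂ → F₂ →L[ℝ] F₂ →L[ℝ] ℝ} {U₁ : Set F₁} {U₂ : Set F₂}
  {y : F₁ × F₂}

/-- The product of two Hermitian metrics. -/
def prodMetric (G₁ : F₁ → F₁ →L[ℝ] F₁ →L[ℝ] ℝ) (G₂ : F₂ → F₂ →L[ℝ] F₂ →L[ℝ] ℝ) (y : F₁ × F₂) :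
    (F₁ × F₂) →L[ℝ] (F₁ × F₂) →L[ℝ] ℝ :=
  prodForm (G₁ y.1) (G₂ y.2)

theorem IsHermitianOn.prod (h₁ : IsHermitianOn G₁ U₁) (h₂ : IsHermitianOn G₂ U₂) :
    IsHermitianOn (prodMetric G₁ G₂) (U₁ ×ˢ U₂) where
  isOpen := h₁.isOpen.prod h₂.isOpen
  smooth := by
    have e : prodMetric G₁ G₂
        = fun y : F₁ × F₂ ↦ fstPull F₁ F₂ (G₁ y.1) + sndPull F₁ F₂ (G₂ y.2) := by
      ext1 y; exact prodForm_eq _ _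
    rw [e]
    refine ContDiffOn.add ?_ ?_
    · exact (fstPull F₁ F₂).contDiff.comp_contDiffOn
        (h₁.smooth.comp contDiff_fst.contDiffOn fun y hy ↦ hy.1)
    · exact (sndPull F₁ F₂).contDiff.comp_contDiffOn
        (h₂.smooth.comp contDiff_snd.contDiffOn fun y hy ↦ hy.2)
  symm y hy u v := by
    simp [prodMetric, h₁.symm _ hy.1 u.1, h₂.symm _ hy.2 u.2]
  pos y hy u hu := by
    have a1 : 0 ≤ G₁ y.1 u.1 u.1 := by
      by_cases h : u.1 = 0
      · simp [h]
      · exact (h₁.pos _ hy.1 _ h).le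
    have a2 : 0 ≤ G₂ y.2 u.2 u.2 := by
      by_cases h : u.2 = 0
      · simp [h]
      · exact (h₂.pos _ hy.2 _ h).le
    simp only [prodMetric, prodForm_apply]
    by_cases h : u.1 = 0
    · have : u.2 ≠ 0 := fun h' ↦ hu (Prod.ext h h')
      linarith [h₂.pos _ hy.2 _ this]
    · linarith [h₁.pos _ hy.1 _ h]
  compatible y hy u v := by
    simp [prodMetric, h₁.compatible _ hy.1, h₂.compatible _ hy.2]

theorem fderiv_prodMetric (h₁ : DifferentiableAt ℝ G₁ y.1) (h₂ : DifferentiableAt ℝ G₂ y.2)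
    (w u v : F₁ × F₂) : fderiv ℝ (prodMetric G₁ G₂) y w u v
      = fderiv ℝ G₁ y.1 w.1 u.1 v.1 + fderiv ℝ G₂ y.2 w.2 u.2 v.2 := by
  have e : prodMetric G₁ G₂
      = fun y : F₁ × F₂ ↦ fstPull F₁ F₂ (G₁ y.1) + sndPull F₁ F₂ (G₂ y.2) := by
    ext1 y; exact prodForm_eq _ _
  have a1 := (fstPull F₁ F₂).hasFDerivAt.comp y
    (h₁.hasFDerivAt.comp y (hasFDerivAt_fst (𝕜 := ℝ)))
  have a2 := (sndPull F₁ F₂).hasFDerivAt.comp y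
    (h₂.hasFDerivAt.comp y (hasFDerivAt_snd (𝕜 := ℝ)))
  have a3 := (a1.add a2).fderiv
  rw [e]
  refine (congrArg (fun L ↦ L w u v) a3).trans ?_
  simp [fstPull, sndPull]

theorem torsionForm_prodMetric (h₁ : DifferentiableAt ℝ G₁ y.1) (h₂ : DifferentiableAt ℝ G₂ y.2)
    (hd : DifferentiableAt ℝ (prodMetric G₁ G₂) y) (u v w : F₁ × F₂) :
    torsionForm (prodMetric G₁ G₂) y u v w
      = torsionForm G₁ y.1 u.1 v.1 w.1 + torsionForm G₂ y.2 u.2 v.2 w.2 := by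
  rw [torsionForm_apply hd, torsionForm_apply h₁, torsionForm_apply h₂]
  simp only [fderiv_prodMetric h₁ h₂, J_fst, J_snd]
  ring

/-- Derivatives of the metric and the torsion form are sums over the factors, so both sides have the
same product with every vector. -/
theorem bismut_prodMetric [FiniteDimensional ℂ F₁] [FiniteDimensional ℂ F₂]
    (h₁ : IsHermitianOn G₁ U₁) (h₂ : IsHermitianOn G₂ U₂) (hy₁ : y.1 ∈ U₁) (hy₂ : y.2 ∈ U₂)
    (u v : F₁ × F₂) : bismut (prodMetric G₁ G₂) y u v
      = (bismut G₁ y.1 u.1 v.1, bismut G₂ y.2 u.2 v.2) := by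
  have h := h₁.prod h₂
  have hy : y ∈ U₁ ×ˢ U₂ := ⟨hy₁, hy₂⟩
  have d₁ := h₁.differentiableAt hy₁
  have d₂ := h₂.differentiableAt hy₂
  refine h.ext_apply hy fun w ↦ ?_
  rw [apply_bismut (h.pos y hy), prodMetric, prodForm_apply, apply_bismut (h₁.pos _ hy₁),
    apply_bismut (h₂.pos _ hy₂), torsionForm_prodMetric d₁ d₂ (h.differentiableAt hy)]
  simp only [fderiv_prodMetric d₁ d₂]
  ring

/-- The curvature of a product connection. -/
theorem curvature_prod {Γ : F₁ × F₂ → F₁ × F₂ → F₁ × F₂ → F₁ × F₂}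
    {Γ₁ : F₁ → F₁ →L[ℝ] F₁ →L[ℝ] F₁} {Γ₂ : F₂ → F₂ →L[ℝ] F₂ →L[ℝ] F₂}
    (hd₁ : DifferentiableAt ℝ Γ₁ y.1) (hd₂ : DifferentiableAt ℝ Γ₂ y.2)
    (h : ∀ᶠ y' in 𝓝 y, ∀ u v, Γ y' u v = (Γ₁ y'.1 u.1 v.1, Γ₂ y'.2 u.2 v.2)) (u v w : F₁ × F₂) :
    curvature Γ y u v w
      = (curvatureCLM Γ₁ y.1 u.1 v.1 w.1, curvatureCLM Γ₂ y.2 u.2 v.2 w.2) := by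
  have key : ∀ u v w, fderiv ℝ (fun y' ↦ Γ y' v w) y u
      = (fderiv ℝ Γ₁ y.1 u.1 v.1 w.1, fderiv ℝ Γ₂ y.2 u.2 v.2 w.2) := by
    intro u v w
    have e : (fun y' ↦ Γ y' v w) =ᶠ[𝓝 y]
        fun y' ↦ (Γ₁ y'.1 v.1 w.1, Γ₂ y'.2 v.2 w.2) := by
      filter_upwards [h] with y' h using h v w
    have a1 := ((hd₁.hasFDerivAt.comp y (hasFDerivAt_fst (𝕜 := ℝ))).clm_apply
      (hasFDerivAt_const v.1 y)).clm_apply (hasFDerivAt_const w.1 y)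
    have a2 := ((hd₂.hasFDerivAt.comp y (hasFDerivAt_snd (𝕜 := ℝ))).clm_apply
      (hasFDerivAt_const v.2 y)).clm_apply (hasFDerivAt_const w.2 y)
    rw [e.fderiv_eq]
    refine (congrArg (fun L ↦ L u) (a1.prodMk a2).fderiv).trans ?_
    simp
  simp only [curvature, key, h.self_of_nhds]
  ext <;> simp [curvatureCLM]

end Product

end HermitianCoord

/-! ### Flatness and closed torsion for g_E / R² on ℂ² ∖ 0 -/

namespace HermitianCoord

section Parallelizable

variable {F : Type*} [NormedAddCommGroup F] [NormedSpace ℂ F]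

/-- The connection whose parallel frame is `L` is flat. -/
theorem curvatureCLM_eq_zero_of_parallel_frame {L : F →L[ℝ] F →L[ℝ] F} {M : F → F →L[ℝ] F}
    {Γ : F → F →L[ℝ] F →L[ℝ] F} {y : F} (hM : DifferentiableAt ℝ M y)
    (hML : ∀ᶠ y' in 𝓝 y, ∀ w, M y' (L y' w) = w) (hLM : ∀ w, L y (M y w) = w)
    (hΓ : ∀ᶠ y' in 𝓝 y, ∀ u v, Γ y' u v = - L u (M y' v)) (hd : DifferentiableAt ℝ Γ y)
    (u v : F) : curvatureCLM Γ y u v = 0 := by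
  -- Derivative of the identity M(y') L(y') c = c at the fixed vector c = M(y) w.
  have h1 : ∀ u w, fderiv ℝ M y u w = - M y (L u (M y w)) := by
    intro u w
    have a1 := hM.hasFDerivAt.clm_apply
      (L.hasFDerivAt.clm_apply (hasFDerivAt_const (M y w) y))
    have a2 := a1.unique ((hasFDerivAt_const (M y w) y).congr_of_eventuallyEq (by
      filter_upwards [hML] with y' h using h (M y w)))
    have a3 := congrArg (fun L ↦ L u) a2
    simp only [hLM] at a3
    simp at a3
    rw [eq_neg_iff_add_eq_zero, add_comm]
    exact a3
  have h2 : ∀ u v w, fderiv ℝ Γ y u v w = - L v (fderiv ℝ M y u w) := by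
    intro u v w
    have a1 := ((L v).hasFDerivAt.comp y (hM.hasFDerivAt.clm_apply (hasFDerivAt_const w y))).neg
    rw [← fderiv_apply₂ hd]
    have e : (fun y' ↦ Γ y' v w) =ᶠ[𝓝 y] - (L v ∘ fun y' ↦ M y' w) := by
      filter_upwards [hΓ] with y' h using h v w
    rw [e.fderiv_eq, a1.fderiv]
    simp
  have h3 := hΓ.self_of_nhds
  ext w
  -- Differentiating Γ produces L v ∘ M ∘ L u ∘ M and its mirror image, which cancel the two
  -- products of coefficients.
  simp [curvatureCLM, h1, h2, h3]

end Parallelizable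

section Hopf

/-- The Euclidean metric of `ℂ²`. -/
def euclid : C2 →L[ℝ] C2 →L[ℝ] ℝ := innerSL ℝ

theorem euclid_apply (u v : C2) : euclid u v = (u 0).re * (v 0).re + (u 0).im * (v 0).im
    + ((u 1).re * (v 1).re + (u 1).im * (v 1).im) := by
  change inner ℝ u v = _
  simp [PiLp.inner_apply, Fin.sum_univ_two]
  ring

theorem euclid_self (u : C2) : euclid u u = ‖u‖ ^ 2 := by
  change inner ℝ u u = _
  exact real_inner_self_eq_norm_sq u

/-- The metric `g_E / R²` on `ℂ² ∖ 0`. -/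
def hopfMetric (y : C2) : C2 →L[ℝ] C2 →L[ℝ] ℝ := (‖y‖ ^ 2)⁻¹ • euclid

theorem hopfMetric_apply (y u v : C2) : hopfMetric y u v = (‖y‖ ^ 2)⁻¹ * euclid u v := rfl

theorem hasFDerivAt_norm_sq_inv {y : C2} (hy : y ≠ 0) :
    HasFDerivAt (fun y : C2 ↦ (‖y‖ ^ 2)⁻¹) ((-2 * ((‖y‖ ^ 2)⁻¹) ^ 2) • euclid y) y := by
  have h1 := (hasStrictFDerivAt_norm_sq y).hasFDerivAt
  have h2 : ‖y‖ ^ 2 ≠ 0 := by positivity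
  refine ((hasDerivAt_inv h2).comp_hasFDerivAt y h1).congr_fderiv ?_
  ext u
  have h3 : (innerSL ℝ) y u = euclid y u := rfl
  simp only [smul_apply, h3, smul_eq_mul, nsmul_eq_mul]
  push_cast
  field_simp

theorem fderiv_hopfMetric {y : C2} (hy : y ≠ 0) (w u v : C2) :
    fderiv ℝ hopfMetric y w u v = -2 * ((‖y‖ ^ 2)⁻¹) ^ 2 * euclid y w * euclid u v := by
  have := ((hasFDerivAt_norm_sq_inv hy).smul_const euclid).fderiv
  change fderiv ℝ (fun y : C2 ↦ (‖y‖ ^ 2)⁻¹ • euclid) y w u v = _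
  rw [this]
  simp

@[simp]
theorem J_C2_re (u : C2) (i : Fin 2) : ((J u) i).re = -(u i).im := by
  simp [J]

@[simp]
theorem J_C2_im (u : C2) (i : Fin 2) : ((J u) i).im = (u i).re := by
  simp [J]

theorem isHermitianOn_hopfMetric : IsHermitianOn hopfMetric {0}ᶜ where
  isOpen := isOpen_compl_singleton
  smooth := by
    refine ContDiffOn.smul (ContDiffOn.inv (contDiff_norm_sq ℝ).contDiffOn ?_) contDiffOn_const
    intro y hy
    have : y ≠ 0 := hy
    positivity
  symm y _ u v := by
    simp only [hopfMetric_apply, euclid_apply]; ring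
  pos y hy u hu := by
    have : y ≠ 0 := hy
    rw [hopfMetric_apply, euclid_self]
    positivity
  compatible y _ u v := by
    simp only [hopfMetric_apply, euclid_apply, J_C2_re, J_C2_im]; ring

/-- The parallel frame of the Bismut connection of the Hopf surface. -/
def hopfFrame : C2 →L[ℝ] C2 →L[ℝ] C2 :=
  LinearMap.toContinuousBilinearMap <| LinearMap.mk₂ ℝ
    -- The quaternion product y·c: the matrix with columns (y₀, y₁) and (-ȳ₁, ȳ₀) applied to c. It
    -- is complex linear in c but only real linear in y.
    (fun y c ↦ !₂[y 0 * c 0 - star (y 1) * c 1, y 1 * c 0 + star (y 0) * c 1])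
    (by intro a b c; ext i; fin_cases i <;> simp <;> ring)
    (by intro a b c; ext i; fin_cases i <;> simp <;> ring)
    (by intro a b c; ext i; fin_cases i <;> simp <;> ring)
    (by intro a b c; ext i; fin_cases i <;> simp <;> ring)

/-- The adjoint of the parallel frame. -/
def hopfFrameAdj : C2 →L[ℝ] C2 →L[ℝ] C2 :=
  LinearMap.toContinuousBilinearMap <| LinearMap.mk₂ ℝ
    (fun y v ↦ !₂[star (y 0) * v 0 + star (y 1) * v 1, - y 1 * v 0 + y 0 * v 1])
    (by intro a b c; ext i; fin_cases i <;> simp <;> ring)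
    (by intro a b c; ext i; fin_cases i <;> simp <;> ring)
    (by intro a b c; ext i; fin_cases i <;> simp <;> ring)
    (by intro a b c; ext i; fin_cases i <;> simp <;> ring)

theorem hopfFrame_apply (y c : C2) : hopfFrame y c
    = !₂[y 0 * c 0 - star (y 1) * c 1, y 1 * c 0 + star (y 0) * c 1] := rfl

theorem hopfFrameAdj_apply (y v : C2) : hopfFrameAdj y v
    = !₂[star (y 0) * v 0 + star (y 1) * v 1, - y 1 * v 0 + y 0 * v 1] := rfl

theorem norm_sq_C2 (y : C2) : ‖y‖ ^ 2
    = (y 0).re * (y 0).re + (y 0).im * (y 0).im + ((y 1).re * (y 1).re + (y 1).im * (y 1).im) := by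
  rw [← euclid_self, euclid_apply]

/-- The matrix of `hopfFrame y` is ‖y‖ times a unitary matrix, so dividing its adjoint by ‖y‖² gives
the inverse. -/
theorem hopfFrameAdj_hopfFrame (y c : C2) : hopfFrameAdj y (hopfFrame y c) = (‖y‖ ^ 2) • c := by
  rw [norm_sq_C2, hopfFrame_apply, hopfFrameAdj_apply]
  ext i
  fin_cases i <;> apply Complex.ext <;> simp <;> ring

theorem hopfFrame_hopfFrameAdj (y c : C2) : hopfFrame y (hopfFrameAdj y c) = (‖y‖ ^ 2) • c := by
  rw [norm_sq_C2, hopfFrame_apply, hopfFrameAdj_apply]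
  ext i
  fin_cases i <;> apply Complex.ext <;> simp <;> ring

/-- The inverse of the parallel frame. -/
def hopfFrameInv (y : C2) : C2 →L[ℝ] C2 := (‖y‖ ^ 2)⁻¹ • hopfFrameAdj y

/-- The Bismut connection of the metric `g_E / R²`. -/
def hopfConnection (y : C2) : C2 →L[ℝ] C2 →L[ℝ] C2 :=
  -((ContinuousLinearMap.compL ℝ C2 C2 C2).flip (hopfFrameInv y)).comp hopfFrame

theorem hopfConnection_apply (y u v : C2) :
    hopfConnection y u v = - hopfFrame u (hopfFrameInv y v) := by
  simp [hopfConnection]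

/-- Parallelism of y ↦ `hopfFrame y c` forces the coefficients -`hopfFrame u` ∘ (`hopfFrame y`)⁻¹.
They are compared with the defining formula of the Bismut connection by pairing with `w`. -/
theorem bismut_hopfMetric {y : C2} (hy : y ≠ 0) (u v : C2) :
    bismut hopfMetric y u v = hopfConnection y u v := by
  have h := isHermitianOn_hopfMetric
  have hN : (‖y‖ ^ 2) ≠ 0 := by positivity
  refine h.ext_apply (y := y) hy fun w ↦ ?_
  rw [apply_bismut (h.pos y hy), torsionForm_apply (h.differentiableAt hy), hopfMetric_apply,
    hopfConnection_apply, hopfFrameInv]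
  simp only [fderiv_hopfMetric hy, smul_apply, map_smul, map_neg, neg_apply]
  simp only [smul_eq_mul]
  -- Both sides of the goal carry the factor -R⁻⁴; what remains is this polynomial identity, with
  -- metric derivatives in the first line and the torsion in the other two.
  have e : euclid (hopfFrame u (hopfFrameAdj y v)) w
      = euclid y u * euclid v w + euclid y v * euclid u w - euclid y w * euclid u v
       + (euclid y (J u) * euclid (J (J v)) (J w) - euclid y (J v) * euclid (J (J u)) (J w)
        + euclid y (J w) * euclid (J (J u)) (J v)) := by
    simp only [euclid_apply, J_C2_re, J_C2_im, hopfFrame_apply, hopfFrameAdj_apply]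
    simp
    ring
  rw [e]
  ring

theorem differentiableAt_hopfFrameInv {y : C2} (hy : y ≠ 0) : DifferentiableAt ℝ hopfFrameInv y :=
  (hasFDerivAt_norm_sq_inv hy).differentiableAt.smul hopfFrameAdj.differentiableAt

theorem differentiableAt_hopfConnection {y : C2} (hy : y ≠ 0) :
    DifferentiableAt ℝ hopfConnection y :=
  (((ContinuousLinearMap.compL ℝ C2 C2 C2).flip.differentiableAt.comp y
    (differentiableAt_hopfFrameInv hy)).clm_comp (differentiableAt_const hopfFrame)).neg

theorem curvatureCLM_hopfConnection {y : C2} (hy : y ≠ 0) (u v : C2) :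
    curvatureCLM hopfConnection y u v = 0 := by
  refine curvatureCLM_eq_zero_of_parallel_frame (L := hopfFrame) (M := hopfFrameInv)
    (differentiableAt_hopfFrameInv hy) ?_ ?_ (Filter.Eventually.of_forall hopfConnection_apply)
    (differentiableAt_hopfConnection hy) u v
  · filter_upwards [isOpen_compl_singleton.mem_nhds hy] with y' hy' w
    have : y' ≠ 0 := hy'
    have hN : (‖y'‖ ^ 2) ≠ 0 := by positivity
    rw [hopfFrameInv, smul_apply, hopfFrameAdj_hopfFrame, smul_smul, inv_mul_cancel₀ hN, one_smul]
  · intro w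
    have hN : (‖y‖ ^ 2) ≠ 0 := by positivity
    rw [hopfFrameInv, smul_apply, map_smul, hopfFrame_hopfFrameAdj, smul_smul, inv_mul_cancel₀ hN,
      one_smul]

/-- The torsion form of the metric `g_E / R²` up to the factor `R⁻⁴`, as a function of the base
point. -/
def hopfTorsion (u v w : C2) : C2 →L[ℝ] ℝ :=
  (-2 : ℝ) • (euclid (J (J v)) (J w) • euclid (J u) - euclid (J (J u)) (J w) • euclid (J v)
    + euclid (J (J u)) (J v) • euclid (J w))

theorem torsionForm_hopfMetric {y : C2} (hy : y ≠ 0) (u v w : C2) :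
    torsionForm hopfMetric y u v w = ((‖y‖ ^ 2)⁻¹) ^ 2 * hopfTorsion u v w y := by
  rw [torsionForm_apply (isHermitianOn_hopfMetric.differentiableAt hy)]
  simp only [fderiv_hopfMetric hy, hopfTorsion, smul_apply, add_apply, sub_apply, smul_eq_mul,
    euclid_apply]
  ring

theorem hasFDerivAt_torsionForm_hopfMetric {y : C2} (hy : y ≠ 0) (u v w : C2) :
    HasFDerivAt (fun y ↦ torsionForm hopfMetric y u v w)
      (((‖y‖ ^ 2)⁻¹) ^ 2 • hopfTorsion u v w
        - (4 * ((‖y‖ ^ 2)⁻¹) ^ 3 * hopfTorsion u v w y) • euclid y) y := by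
  have h := ((hasFDerivAt_norm_sq_inv hy).pow 2).mul (hopfTorsion u v w).hasFDerivAt
  refine HasFDerivAt.congr_of_eventuallyEq ?_ (f := fun y ↦
    ((‖y‖ ^ 2)⁻¹) ^ 2 * hopfTorsion u v w y) ?_
  · refine h.congr_fderiv ?_
    ext z
    simp only [smul_apply, add_apply, sub_apply, smul_eq_mul, nsmul_eq_mul]
    push_cast
    ring
  · filter_upwards [isOpen_compl_singleton.mem_nhds hy] with y' hy'
    exact torsionForm_hopfMetric hy' u v w

/-- Write H = R⁻⁴ T with T linear in y. Then dH = R⁻⁴ dT - 4 R⁻⁶ y♭ ∧ T, so closedness means R² dT =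
4 y♭ ∧ T. This holds because T is a multiple of the contraction of the volume form with y. -/
theorem extDeriv₃_torsionForm_hopfMetric {y : C2} (hy : y ≠ 0) (u v w z : C2) :
    extDeriv₃ (fun y u v w ↦ torsionForm hopfMetric y u v w) y u v w z = 0 := by
  simp only [extDeriv₃, (hasFDerivAt_torsionForm_hopfMetric hy _ _ _).fderiv, sub_apply, smul_apply,
    smul_eq_mul]
  have hN : (‖y‖ ^ 2) ≠ 0 := by positivity
  have e1 : euclid y y * (hopfTorsion v w z u - hopfTorsion u w z v + hopfTorsion u v z w
      - hopfTorsion u v w z) = 4 * (euclid y u * hopfTorsion v w z y - euclid y v * hopfTorsion u w z y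
      + euclid y w * hopfTorsion u v z y - euclid y z * hopfTorsion u v w y) := by
    simp only [hopfTorsion, smul_apply, add_apply, sub_apply, smul_eq_mul, euclid_apply,
      J_C2_re, J_C2_im]
    ring
  rw [euclid_self] at e1
  field_simp
  linear_combination e1

end Hopf

end HermitianCoord

/-! ### Maps between manifolds read in charts -/

section SelfModel

variable {F : Type*} [NormedAddCommGroup F]
  {M : Type*} [TopologicalSpace M] [ChartedSpace F M]
  {F' : Type*} [NormedAddCommGroup F'] {M' : Type*} [TopologicalSpace M'] [ChartedSpace F' M']

theorem contMDiffAt_self_iff {𝕜 : Type*} [NontriviallyNormedField 𝕜] [NormedSpace 𝕜 F]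
    [NormedSpace 𝕜 F'] {f : M → M'} {x : M} {n : WithTop ℕ∞} :
    ContMDiffAt 𝓘(𝕜, F) 𝓘(𝕜, F') n f x ↔ ContinuousAt f x ∧
      ContDiffAt 𝕜 n (chartAt F' (f x) ∘ f ∘ (chartAt F x).symm) (chartAt F x x) := by
  rw [contMDiffAt_iff]
  simp [contDiffWithinAt_univ, mfld_simps]

theorem mdifferentiableAt_self_iff {𝕜 : Type*} [NontriviallyNormedField 𝕜] [NormedSpace 𝕜 F]
    [NormedSpace 𝕜 F'] {f : M → M'} {x : M} :
    MDifferentiableAt 𝓘(𝕜, F) 𝓘(𝕜, F') f x ↔ ContinuousAt f x ∧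
      DifferentiableAt 𝕜 (chartAt F' (f x) ∘ f ∘ (chartAt F x).symm) (chartAt F x x) := by
  rw [mdifferentiableAt_iff]
  simp [writtenInExtChartAt, differentiableWithinAt_univ, mfld_simps]

theorem mfderiv_self {𝕜 : Type*} [NontriviallyNormedField 𝕜] [NormedSpace 𝕜 F]
    [NormedSpace 𝕜 F'] {f : M → M'} {x : M} (hf : MDifferentiableAt 𝓘(𝕜, F) 𝓘(𝕜, F') f x) :
    mfderiv 𝓘(𝕜, F) 𝓘(𝕜, F') f x
      = fderiv 𝕜 (chartAt F' (f x) ∘ f ∘ (chartAt F x).symm) (chartAt F x x) := by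
  rw [hf.mfderiv]
  simp only [writtenInExtChartAt, fderivWithin_univ, mfld_simps]
  rfl

end SelfModel

section CoordMap

variable {F : Type*} [NormedAddCommGroup F]
  {M : Type*} [TopologicalSpace M] [ChartedSpace F M]
  {M' : Type*} [TopologicalSpace M'] [ChartedSpace F M']

/-- The set of points in the chart at `c` which `f` maps into the chart at `c'`. -/
def coordDomain (f : M → M') (c : M) (c' : M') : Set F :=
  (chartAt F c).target ∩ (chartAt F c).symm ⁻¹' (f ⁻¹' (chartAt F c').source)

/-- The coordinate expression of a map. -/
def coordMap (f : M → M') (c : M) (c' : M') : F → F :=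
  chartAt F c' ∘ f ∘ (chartAt F c).symm

theorem coordMap_apply_center (f : M → M') (c : M) :
    coordMap (F := F) f c (f c) (chartAt F c c) = chartAt F (f c) (f c) := by
  simp [coordMap]

theorem isOpen_coordDomain {f : M → M'} (hf : Continuous f) (c : M) (c' : M') :
    IsOpen (coordDomain (F := F) f c c') :=
  (chartAt F c).isOpen_inter_preimage_symm ((chartAt F c').open_source.preimage hf)

theorem mem_coordDomain_center (f : M → M') (c : M) :
    chartAt F c c ∈ coordDomain (F := F) f c (f c) := by
  simp [coordDomain]

theorem mapsTo_coordMap (f : M → M') (c : M) (c' : M') :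
    Set.MapsTo (coordMap f c c') (coordDomain (F := F) f c c') (chartAt F c').target :=
  fun _ hy ↦ (chartAt F c').map_source hy.2

/-- The field is left free: ℂ serves for coordinate changes and deck transformations, ℝ for
isometries. -/
theorem contDiffAt_coordMap {𝕜 : Type*} [NontriviallyNormedField 𝕜] [NormedSpace 𝕜 F]
    [IsManifold 𝓘(𝕜, F) ω M] [IsManifold 𝓘(𝕜, F) ω M'] {f : M → M'}
    (hf : ContMDiff 𝓘(𝕜, F) 𝓘(𝕜, F) ω f) {c : M} {c' : M'} {y : F}
    (hy : y ∈ coordDomain (F := F) f c c') : ContDiffAt 𝕜 ω (coordMap f c c') y := by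
  rw [← contMDiffAt_iff_contDiffAt]
  have h1 : ContMDiffAt 𝓘(𝕜, F) 𝓘(𝕜, F) ω (chartAt F c).symm y :=
    (contMDiffOn_chart_symm (I := 𝓘(𝕜, F)) (n := ω) (x := c)).contMDiffAt
      ((chartAt F c).open_target.mem_nhds hy.1)
  have h2 : ContMDiffAt 𝓘(𝕜, F) 𝓘(𝕜, F) ω (chartAt F c') (f ((chartAt F c).symm y)) :=
    (contMDiffOn_chart (I := 𝓘(𝕜, F)) (n := ω) (x := c')).contMDiffAt
      ((chartAt F c').open_source.mem_nhds hy.2)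
  exact h2.comp y ((hf _).comp y h1)

end CoordMap

/-! ### Underlying real structure and coordinate expressions of metrics -/

section RealManifold

variable {F : Type*} [NormedAddCommGroup F] [NormedSpace ℂ F]
  {M : Type*} [TopologicalSpace M] [ChartedSpace F M]
  {F' : Type*} [NormedAddCommGroup F'] [NormedSpace ℂ F']
  {M' : Type*} [TopologicalSpace M'] [ChartedSpace F' M']

variable (F M) in
/-- A complex manifold is a real analytic manifold. -/
theorem isManifold_real [IsManifold 𝓘(ℂ, F) ω M] : IsManifold (realModel F) ω M := by
  refine isManifold_of_contDiffOn _ _ _ fun e e' he he' ↦ ?_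
  have h1 := (contDiffGroupoid ω 𝓘(ℂ, F)).compatible he he'
  rw [contDiffGroupoid, mem_groupoid_of_pregroupoid] at h1
  have h2 : ContDiffOn ℂ ω (e.symm ≫ₕ e') (e.symm ≫ₕ e').source := by
    simpa [contDiffPregroupoid] using h1.1
  simpa using h2.restrict_scalars ℝ

theorem ContMDiffAt.to_real {f : M → M'} {x : M} {n : WithTop ℕ∞}
    (hf : ContMDiffAt 𝓘(ℂ, F) 𝓘(ℂ, F') n f x) :
    ContMDiffAt (realModel F) (realModel F') n f x := by
  rw [contMDiffAt_self_iff] at hf ⊢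
  exact ⟨hf.1, hf.2.restrict_scalars ℝ⟩

theorem fderiv_J {φ : F → F'} {y : F} (hφ : DifferentiableAt ℂ φ y) (u : F) :
    fderiv ℝ φ y (HermitianCoord.J u) = HermitianCoord.J (fderiv ℝ φ y u) := by
  rw [hφ.fderiv_restrictScalars ℝ]
  simp [HermitianCoord.J]

/-- The real differential of a holomorphic map commutes with the complex structures. -/
theorem mfderiv_tangentJ {f : M → M'} {x : M}
    (hf : MDifferentiableAt 𝓘(ℂ, F) 𝓘(ℂ, F') f x) (u : TangentSpace (realModel F) x) :
    mfderiv (realModel F) (realModel F') f x (tangentJ x u)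
      = tangentJ (f x) (mfderiv (realModel F) (realModel F') f x u) := by
  have h := mdifferentiableAt_self_iff.1 hf
  have hr : MDifferentiableAt (realModel F) (realModel F') f x :=
    mdifferentiableAt_self_iff.2 ⟨h.1, h.2.restrictScalars ℝ⟩
  rw [mfderiv_self hr]
  exact fderiv_J h.2 u

end RealManifold

section CoordExpr

variable {F : Type*} [NormedAddCommGroup F] [NormedSpace ℂ F]
  {M : Type*} [TopologicalSpace M] [ChartedSpace F M]
  {M' : Type*} [TopologicalSpace M'] [ChartedSpace F M']

theorem mdifferentiableAt_chart_symm [IsManifold (realModel F) ω M] {c : M} {y : F}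
    (hy : y ∈ (chartAt F c).target) :
    MDifferentiableAt (realModel F) (realModel F) (chartAt F c).symm y :=
  have : IsManifold (realModel F) 1 M := .of_le (n := ω) le_top
  mdifferentiableAt_atlas_symm (chart_mem_atlas F c) hy

theorem mdifferentiableAt_chart' [IsManifold (realModel F) ω M] {c : M} {x : M}
    (hx : x ∈ (chartAt F c).source) :
    MDifferentiableAt (realModel F) (realModel F) (chartAt F c) x :=
  have : IsManifold (realModel F) 1 M := .of_le (n := ω) le_top
  mdifferentiableAt_atlas (chart_mem_atlas F c) hx

/-- The coordinate expression of a pulled back field of bilinear forms is the pullback of the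
coordinate expression. -/
theorem coordExpr_pullback [IsManifold (realModel F) ω M] [IsManifold (realModel F) ω M']
    {g : BilinField F M} {g' : BilinField F M'} {f : M → M'} {c : M} {c' : M'} {y : F}
    (hy : y ∈ coordDomain (F := F) f c c')
    (hf : MDifferentiableAt (realModel F) (realModel F) f ((chartAt F c).symm y))
    (hg : ∀ u v, g' (f ((chartAt F c).symm y))
        (mfderiv (realModel F) (realModel F) f ((chartAt F c).symm y) u)
        (mfderiv (realModel F) (realModel F) f ((chartAt F c).symm y) v)
      = g ((chartAt F c).symm y) u v) (u v : F) :
    coordExpr g c y u v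
      = coordExpr g' c' (coordMap f c c' y) (fderiv ℝ (coordMap f c c') y u)
          (fderiv ℝ (coordMap f c c') y v) := by
  have h1 := mdifferentiableAt_chart_symm (M := M) hy.1
  have h2 := mdifferentiableAt_chart' (M := M') hy.2
  have h3 := mdifferentiableAt_chart_symm (M := M') (mapsTo_coordMap f c c' hy)
  have h4 : MDifferentiableAt (realModel F) (realModel F) (coordMap f c c') y :=
    h2.comp y (hf.comp y h1)
  have hbase : (chartAt F c').symm (coordMap f c c' y) = f ((chartAt F c).symm y) :=
    (chartAt F c').left_inv hy.2
  -- Two factorizations of the same map near `y`; the chain rule applied to both compares the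
  -- differentials of `f` and of its coordinate expression.
  have e : (f ∘ (chartAt F c).symm) =ᶠ[𝓝 y] ((chartAt F c').symm ∘ coordMap f c c') := by
    have hc : ContinuousAt (f ∘ (chartAt F c).symm) y := (hf.comp y h1).continuousAt
    filter_upwards [hc.preimage_mem_nhds ((chartAt F c').open_source.mem_nhds hy.2)] with z hz
    exact ((chartAt F c').left_inv hz).symm
  have hD : ∀ u : F, (mfderiv (realModel F) (realModel F) f ((chartAt F c).symm y)
      (mfderiv (realModel F) (realModel F) (chartAt F c).symm y u) : F)
      = (mfderiv (realModel F) (realModel F) (chartAt F c').symm (coordMap f c c' y)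
        (fderiv ℝ (coordMap f c c') y u) : F) := by
    intro u
    have a1 := mfderiv_comp y hf h1
    have a2 := mfderiv_comp y h3 h4
    have a3 := e.mfderiv_eq (I := realModel F) (I' := realModel F)
    rw [a1, a2, mfderiv_eq_fderiv] at a3
    exact congrArg (fun L : F →L[ℝ] F ↦ L u) a3
  have hb : (g' ((chartAt F c').symm (coordMap f c c' y)) : F →L[ℝ] F →L[ℝ] ℝ)
      = g' (f ((chartAt F c).symm y)) := by rw [hbase]
  have hL : coordExpr g c y u v = (g ((chartAt F c).symm y) : F →L[ℝ] F →L[ℝ] ℝ)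
    (mfderiv (realModel F) (realModel F) (chartAt F c).symm y u : F)
    (mfderiv (realModel F) (realModel F) (chartAt F c).symm y v : F) := rfl
  have hR : ∀ a b : F, coordExpr g' c' (coordMap f c c' y) a b
    = (g' ((chartAt F c').symm (coordMap f c c' y)) : F →L[ℝ] F →L[ℝ] ℝ)
    (mfderiv (realModel F) (realModel F) (chartAt F c').symm (coordMap f c c' y) a : F)
    (mfderiv (realModel F) (realModel F) (chartAt F c').symm (coordMap f c c' y) b : F) :=
      fun a b ↦ rfl
  rw [hL, hR, ← hD, ← hD, hb]
  exact (hg _ _).symm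

end CoordExpr

/-! ### From metrics on a manifold to metrics in charts -/

section HermitianManifold

open HermitianCoord

variable {F : Type*} [NormedAddCommGroup F] [NormedSpace ℂ F]
  {M : Type*} [TopologicalSpace M] [ChartedSpace F M]

theorem mfderiv_chart_symm_injective [IsManifold (realModel F) ω M] {c : M} {y : F}
    (hy : y ∈ (chartAt F c).target) :
    Function.Injective (mfderiv (realModel F) (realModel F) (chartAt F c).symm y) := by
  have h1 := mdifferentiableAt_chart_symm hy
  have h2 := mdifferentiableAt_chart' ((chartAt F c).map_target hy)
  have e : (chartAt F c ∘ (chartAt F c).symm) =ᶠ[𝓝 y] id := by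
    filter_upwards [(chartAt F c).open_target.mem_nhds hy] with z hz
    exact (chartAt F c).right_inv hz
  have h3 := e.mfderiv_eq (I := realModel F) (I' := realModel F)
  rw [mfderiv_comp y h2 h1, mfderiv_id] at h3
  exact Function.LeftInverse.injective
    (g := mfderiv (realModel F) (realModel F) (chartAt F c) ((chartAt F c).symm y))
    fun u ↦ congrArg (fun L : F →L[ℝ] F ↦ L u) h3

theorem mdifferentiableAt_complex_chart_symm [IsManifold 𝓘(ℂ, F) ω M] {c : M} {y : F}
    (hy : y ∈ (chartAt F c).target) :
    MDifferentiableAt 𝓘(ℂ, F) 𝓘(ℂ, F) (chartAt F c).symm y :=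
  have : IsManifold 𝓘(ℂ, F) 1 M := .of_le (n := ω) le_top
  mdifferentiableAt_atlas_symm (chart_mem_atlas F c) hy

theorem coordExpr_apply (g : BilinField F M) (c : M) (y u v : F) :
    coordExpr g c y u v = g ((chartAt F c).symm y)
      (mfderiv (realModel F) (realModel F) (chartAt F c).symm y u)
      (mfderiv (realModel F) (realModel F) (chartAt F c).symm y v) := rfl

theorem IsHermitianMetric.isHermitianOn [IsManifold 𝓘(ℂ, F) ω M] {g : BilinField F M}
    (hg : IsHermitianMetric g) (c : M) : IsHermitianOn (coordExpr g c) (chartAt F c).target where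
  isOpen := (chartAt F c).open_target
  smooth := hg.smooth c
  symm y _ u v := by
    rw [coordExpr_apply, coordExpr_apply]
    exact hg.symm _ _ _
  pos y hy u hu := by
    have := isManifold_real F M
    refine hg.pos _ _ fun h ↦ hu (mfderiv_chart_symm_injective hy (h.trans ?_))
    exact (map_zero (mfderiv (realModel F) (realModel F) (chartAt F c).symm y)).symm
  compatible y hy u v := by
    have h := fun u : F ↦ mfderiv_tangentJ (mdifferentiableAt_complex_chart_symm hy) u
    have h' : ∀ u : F, mfderiv (realModel F) (realModel F) (chartAt F c).symm y (J (F := F) u)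
      = tangentJ _ (mfderiv (realModel F) (realModel F) (chartAt F c).symm y u) := h
    rw [coordExpr_apply, coordExpr_apply, h', h']
    exact hg.compatible _ _ _

theorem HermitianCoord.IsHermitianOn.differentiableAt_fundamentalForm
    {G : F → F →L[ℝ] F →L[ℝ] ℝ} {U : Set F} {y : F} (hG : IsHermitianOn G U) (hy : y ∈ U) :
    DifferentiableAt ℝ (fundamentalForm G) y :=
  (hG.differentiableAt hy).clm_comp (differentiableAt_const J)

theorem HermitianCoord.IsHermitianOn.fundamentalForm_skew
    {G : F → F →L[ℝ] F →L[ℝ] ℝ} {U : Set F} {y : F} (hG : IsHermitianOn G U) (hy : y ∈ U)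
    (u v : F) : fundamentalForm G y u v = - fundamentalForm G y v u := by
  have h : G y (J u) v = - G y (J v) u := by
    rw [hG.symm y hy (J v) u, ← hG.compatible y hy u (J v), J_J, map_neg, neg_neg]
  exact h

/-- Closedness is given only at the centre of each preferred chart, whereas connections must be
known on a neighbourhood. A point of the chart is moved to the centre of its own chart by a
holomorphic coordinate change, which commutes with J and so pulls back fundamental forms. -/
theorem IsKahlerMetric.isClosedOn [IsManifold 𝓘(ℂ, F) ω M] {g : BilinField F M}
    (hg : IsKahlerMetric g) (c : M) : IsClosedOn (coordExpr g c) (chartAt F c).target := by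
  intro y hy u v w
  have := isManifold_real F M
  set x : M := (chartAt F c).symm y with hx
  -- The coordinate expression of the identity map between the two charts is the transition map.
  have hy' : y ∈ coordDomain (F := F) (id : M → M) c x := ⟨hy, mem_chart_source F x⟩
  have hφ : ∀ {z}, z ∈ coordDomain (F := F) (id : M → M) c x →
      ContDiffAt ℂ ω (coordMap (id : M → M) c x) z := fun hz ↦ contDiffAt_coordMap contMDiff_id hz
  have hyx : coordMap (id : M → M) c x y = chartAt F x x := rfl
  have hx0 : coordMap (id : M → M) c x y ∈ (chartAt F x).target := mapsTo_coordMap _ _ _ hy'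
  rw [extDeriv₂_pullback (isOpen_coordDomain continuous_id c x)
    (fun z hz ↦ ((hφ hz).restrict_scalars ℝ).contDiffWithinAt.of_le le_top) hy'
    ((hg.isHermitianOn c).differentiableAt_fundamentalForm hy)
    ((hg.isHermitianOn x).differentiableAt_fundamentalForm hx0)
    ((hg.isHermitianOn x).fundamentalForm_skew hx0), hyx]
  · exact hg.closed x _ _ _
  · intro z hz u v
    change coordExpr g c z (J u) v = coordExpr g x _ (J _) _
    rw [coordExpr_pullback (g' := g) hz mdifferentiableAt_id, fderiv_J
      ((hφ hz).differentiableAt (by simp))]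
    intro u v
    rw [mfderiv_id]
    rfl

theorem coordMap_isLocalIsometryOn [IsManifold (realModel F) ω M]
    {M' : Type*} [TopologicalSpace M'] [ChartedSpace F M'] [IsManifold (realModel F) ω M']
    {g : BilinField F M} {g' : BilinField F M'} {f : M → M'}
    (hf : ContMDiff (realModel F) (realModel F) ω f)
    (hiso : ∀ x u v, g' (f x) (mfderiv (realModel F) (realModel F) f x u)
      (mfderiv (realModel F) (realModel F) f x v) = g x u v) (c : M) (c' : M') :
    IsLocalIsometryOn (coordExpr g c) (coordExpr g' c') (coordDomain f c c') (chartAt F c').target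
      (coordMap f c c') where
  isOpen := isOpen_coordDomain hf.continuous c c'
  smooth z hz := (contDiffAt_coordMap hf hz).contDiffWithinAt.of_le le_top
  mapsTo := mapsTo_coordMap f c c'
  pullback y hy u v := coordExpr_pullback hy ((hf _).mdifferentiableAt (by simp)) (hiso _) u v

theorem IsHermitianMetric.curvature_leviCivita [FiniteDimensional ℂ F] [IsManifold 𝓘(ℂ, F) ω M]
    {g : BilinField F M} (hg : IsHermitianMetric g) (c : M) (u v w : F) :
    curvature (leviCivita (coordExpr g c)) (chartAt F c c) u v w
      = curvatureCLM (christoffel (coordExpr g c)) (chartAt F c c) u v w :=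
  curvature_eq (Filter.Eventually.of_forall fun y u v ↦ (christoffel_apply _ y u v).symm)
    (((hg.isHermitianOn c).contDiffAt_christoffel (mem_chart_target F c)).differentiableAt
      (by simp)) u v w

/-- The Riemannian curvature is invariant under isometries. -/
theorem riemannCurvature_isometry [FiniteDimensional ℂ F] [IsManifold 𝓘(ℂ, F) ω M]
    {g : BilinField F M} (hg : IsHermitianMetric g) {f : M → M}
    (hf : ContMDiff (realModel F) (realModel F) ω f)
    (hiso : ∀ x u v, g (f x) (mfderiv (realModel F) (realModel F) f x u)
      (mfderiv (realModel F) (realModel F) f x v) = g x u v)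
    (x : M) (u v w z : TangentSpace (realModel F) x) :
    riemannCurvature g (f x) (mfderiv (realModel F) (realModel F) f x u)
      (mfderiv (realModel F) (realModel F) f x v) (mfderiv (realModel F) (realModel F) f x w)
      (mfderiv (realModel F) (realModel F) f x z) = riemannCurvature g x u v w z := by
  have := isManifold_real F M
  have h1 : ∀ u v w : F, fderiv ℝ (coordMap f x (f x)) (chartAt F x x)
      (curvature (leviCivita (coordExpr g x)) (chartAt F x x) u v w)
      = curvature (leviCivita (coordExpr g (f x))) (chartAt F (f x) (f x))
        (fderiv ℝ (coordMap f x (f x)) (chartAt F x x) u)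
        (fderiv ℝ (coordMap f x (f x)) (chartAt F x x) v)
        (fderiv ℝ (coordMap f x (f x)) (chartAt F x x) w) := by
    intro u v w
    rw [hg.curvature_leviCivita x, hg.curvature_leviCivita (f x), ← coordMap_apply_center f x]
    exact (coordMap_isLocalIsometryOn hf hiso x (f x)).curvature (hg.isHermitianOn x)
      Set.inter_subset_left (hg.isHermitianOn (f x)) (mem_coordDomain_center f x) u v w
  have h2 : mfderiv (realModel F) (realModel F) f x
      = fderiv ℝ (coordMap f x (f x)) (chartAt F x x) :=
    mfderiv_self ((hf x).mdifferentiableAt (by simp))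
  have h3 := hiso x (curvature (F := F) (leviCivita (coordExpr g x)) (chartAt F x x) u v w) z
  rw [riemannCurvature, riemannCurvature, ← h3]
  congr 2
  rw [h2]
  exact (h1 u v w).symm

end HermitianManifold

/-- The value of a field of bilinear forms at a point, as a form on the model space. -/
def BilinField.form {F : Type*} [NormedAddCommGroup F] [NormedSpace ℂ F] {M : Type*}
    [TopologicalSpace M] [ChartedSpace F M] (g : BilinField F M) (x : M) : F →L[ℝ] F →L[ℝ] ℝ :=
  g x

/-- The real differential of a map, as a linear map between the model spaces. -/
def realDeriv {F F' : Type*} [NormedAddCommGroup F] [NormedSpace ℂ F] [NormedAddCommGroup F']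
    [NormedSpace ℂ F'] {M M' : Type*} [TopologicalSpace M] [ChartedSpace F M] [TopologicalSpace M']
    [ChartedSpace F' M'] (f : M → M') (x : M) : F →L[ℝ] F' :=
  mfderiv (realModel F) (realModel F') f x

theorem realDeriv_eq {F F' : Type*} [NormedAddCommGroup F] [NormedSpace ℂ F] [NormedAddCommGroup F']
    [NormedSpace ℂ F'] {M M' : Type*} [TopologicalSpace M] [ChartedSpace F M] [TopologicalSpace M']
    [ChartedSpace F' M'] {f : M → M'} {x : M}
    (hf : MDifferentiableAt (realModel F) (realModel F') f x) : realDeriv (F := F) (F' := F') f x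
      = fderiv ℝ (chartAt F' (f x) ∘ f ∘ (chartAt F x).symm) (chartAt F x x) :=
  mfderiv_self hf

/-! ### The product manifold K × (ℂ² ∖ 0) and its scalings -/

section ScaleMap

variable {K : Type*} [TopologicalSpace K]

/-- The map `(p, x) ↦ (φ p, c x)`. -/
def scaleMap (φ : K → K) {c : ℝ} (hc : c ≠ 0) (a : K × PuncturedC2) : K × PuncturedC2 :=
  (φ a.1, ⟨c • (a.2 : C2), smul_ne_zero hc a.2.2⟩)

theorem continuous_scaleMap {φ : K → K} (hφ : Continuous φ) {c : ℝ} (hc : c ≠ 0) :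
    Continuous (scaleMap φ hc) := by
  refine (hφ.comp continuous_fst).prodMk (Continuous.subtype_mk ?_ _)
  exact (continuous_subtype_val.comp continuous_snd).const_smul c

end ScaleMap

section PuncturedPlane

theorem puncturedChartAt_target (x : PuncturedC2) : (chartAt C2 x).target = {0}ᶜ := by
  rw [TopologicalSpace.Opens.chartAt_eq]
  simp only [OpenPartialHomeomorph.subtypeRestr_def, chartAt_self_eq]
  ext y
  simp

/-- Every chart of ℂ² ∖ 0 is the inclusion; off zero its inverse does not move the point. -/
theorem puncturedChartAt_symm_apply (x : PuncturedC2) {y : C2} (hy : y ≠ 0) :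
    (((chartAt C2 x).symm y : PuncturedC2) : C2) = y :=
  (chartAt C2 x).right_inv (by rw [puncturedChartAt_target]; exact hy)

variable {E : Type*} [NormedAddCommGroup E]
  {K : Type*} [TopologicalSpace K] [ChartedSpace E K]

theorem productChartAt_target (a : K × PuncturedC2) :
    (chartAt (E × C2) a).target = (chartAt E a.1).target ×ˢ {0}ᶜ := by
  rw [← puncturedChartAt_target a.2]
  rfl

theorem scaleMap_coord (φ : K → K) {c : ℝ} (hc : c ≠ 0) (a : K × PuncturedC2) :
    (chartAt (E × C2) (scaleMap φ hc a) ∘ scaleMap φ hc ∘ (chartAt (E × C2) a).symm)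
      =ᶠ[𝓝 (chartAt (E × C2) a a)]
      Prod.map (chartAt E (φ a.1) ∘ φ ∘ (chartAt E a.1).symm) (fun x : C2 ↦ c • x) := by
  filter_upwards [(chartAt (E × C2) a).open_target.mem_nhds (mem_chart_target _ a)] with z hz
  rw [productChartAt_target] at hz
  refine Prod.ext rfl ?_
  change c • (((chartAt C2 a.2).symm z.2 : PuncturedC2) : C2) = c • z.2
  rw [puncturedChartAt_symm_apply a.2 hz.2]

end PuncturedPlane

section ProductManifold

open HermitianCoord

variable {E : Type*} [NormedAddCommGroup E] [NormedSpace ℂ E]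
  {K : Type*} [TopologicalSpace K] [ChartedSpace E K]

instance productIsManifold [IsManifold 𝓘(ℂ, E) ω K] :
    IsManifold 𝓘(ℂ, E × C2) ω (K × PuncturedC2) := by
  rw [modelWithCornersSelf_prod]
  exact IsManifold.prod (I := 𝓘(ℂ, E)) (I' := 𝓘(ℂ, C2)) K PuncturedC2

theorem productMetric_apply (g : BilinField E K) (a : K × PuncturedC2) (u v : E × C2) :
    (productMetric g).form a u v = g.form a.1 u.1 v.1 + hopfMetric a.2 u.2 v.2 := by
  rfl

theorem realDeriv_productChart_symm [IsManifold 𝓘(ℂ, E) ω K] {a : K × PuncturedC2} {y : E × C2}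
    (hy : y ∈ (chartAt (E × C2) a).target) (u : E × C2) :
    realDeriv (F := E × C2) (F' := E × C2) (chartAt (E × C2) a).symm y u
      = (realDeriv (F := E) (F' := E) (chartAt E a.1).symm y.1 u.1, u.2) := by
  have := isManifold_real E K
  have := isManifold_real (E × C2) (K × PuncturedC2)
  have hy' := hy
  rw [productChartAt_target] at hy'
  have h1 := mdifferentiableAt_chart_symm hy
  have h2 := mdifferentiableAt_chart_symm hy'.1
  have d2 := (mdifferentiableAt_self_iff.1 h2).2
  rw [realDeriv_eq h1, realDeriv_eq h2]
  have e : (chartAt (E × C2) ((chartAt (E × C2) a).symm y) ∘ (chartAt (E × C2) a).symm ∘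
      (chartAt (E × C2) y).symm) =ᶠ[𝓝 y]
      Prod.map (chartAt E ((chartAt E a.1).symm y.1) ∘ (chartAt E a.1).symm ∘
        (chartAt E y.1).symm) id := by
    filter_upwards [(chartAt (E × C2) a).open_target.mem_nhds hy] with z hz
    rw [productChartAt_target] at hz
    exact Prod.ext rfl (puncturedChartAt_symm_apply a.2 hz.2)
  change fderiv ℝ (chartAt (E × C2) ((chartAt (E × C2) a).symm y) ∘ (chartAt (E × C2) a).symm ∘
      (chartAt (E × C2) y).symm) y u = _
  rw [e.fderiv_eq]
  have h3 := (HasFDerivAt.prodMap (p := y) d2.hasFDerivAt (hasFDerivAt_id (𝕜 := ℝ) y.2)).fderiv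
  refine (congrArg (fun L ↦ L u) h3).trans ?_
  rfl

theorem coordExpr_productMetric [IsManifold 𝓘(ℂ, E) ω K] (g : BilinField E K) (a : K × PuncturedC2)
    {y : E × C2} (hy : y ∈ (chartAt (E × C2) a).target) :
    coordExpr (productMetric g) a y = prodMetric (coordExpr g a.1) hopfMetric y := by
  have hy' := hy
  rw [productChartAt_target] at hy'
  have key : ∀ u v : E × C2, coordExpr (productMetric g) a y u v
      = prodMetric (coordExpr g a.1) hopfMetric y u v := by
    intro u v
    have h : ∀ w, realDeriv (F := E × C2) (F' := E × C2) (chartAt (E × C2) a).symm y w = _ :=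
      realDeriv_productChart_symm hy
    change (productMetric g).form ((chartAt (E × C2) a).symm y)
      (realDeriv (F := E × C2) (F' := E × C2) (chartAt (E × C2) a).symm y u)
      (realDeriv (F := E × C2) (F' := E × C2) (chartAt (E × C2) a).symm y v) = _
    rw [h, h, productMetric_apply, prodMetric, prodForm_apply]
    congr 1
    change hopfMetric ((chartAt C2 a.2).symm y.2 : PuncturedC2) u.2 v.2 = _
    rw [puncturedChartAt_symm_apply a.2 hy'.2]
  exact ContinuousLinearMap.ext fun u ↦ ContinuousLinearMap.ext fun v ↦ key u v

theorem contMDiff_scaleMap {φ : K → K} (hφ : ContMDiff 𝓘(ℂ, E) 𝓘(ℂ, E) ω φ) {c : ℝ} (hc : c ≠ 0) :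
    ContMDiff 𝓘(ℂ, E × C2) 𝓘(ℂ, E × C2) ω (scaleMap φ hc) := by
  intro a
  have h1 := contMDiffAt_self_iff.1 (hφ a.1)
  refine contMDiffAt_self_iff.2 ⟨?_, ?_⟩
  · exact (continuous_scaleMap hφ.continuous hc).continuousAt
  · refine ContDiffAt.congr_of_eventuallyEq ?_ (scaleMap_coord φ hc a)
    refine ContDiffAt.prodMap' (p := chartAt (E × C2) a a) h1.2 ?_
    -- The real scalar is read as a complex one to obtain holomorphy.
    have : (fun x : C2 ↦ c • x) = fun x : C2 ↦ (c : ℂ) • x := by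
      ext x i
      simp
    rw [this]
    exact contDiffAt_id.const_smul (c : ℂ)

theorem realDeriv_scaleMap {φ : K → K} (hφ : ContMDiff 𝓘(ℂ, E) 𝓘(ℂ, E) ω φ) {c : ℝ} (hc : c ≠ 0)
    (a : K × PuncturedC2) (u : E × C2) :
    realDeriv (F := E × C2) (F' := E × C2) (scaleMap φ hc) a u
      = (realDeriv (F := E) (F' := E) φ a.1 u.1, c • u.2) := by
  have h1 : MDifferentiableAt (realModel (E × C2)) (realModel (E × C2)) (scaleMap φ hc) a :=
    (contMDiff_scaleMap hφ hc a).to_real.mdifferentiableAt (by simp)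
  have h2 : MDifferentiableAt (realModel E) (realModel E) φ a.1 :=
    (hφ a.1).to_real.mdifferentiableAt (by simp)
  have d2 := (mdifferentiableAt_self_iff.1 h2).2
  rw [realDeriv_eq h1, realDeriv_eq h2, (scaleMap_coord φ hc a).fderiv_eq]
  have h3 := (HasFDerivAt.prodMap (p := chartAt (E × C2) a a) d2.hasFDerivAt
    ((hasFDerivAt_id (𝕜 := ℝ) (chartAt (E × C2) a a).2).const_smul c)).fderiv
  refine (congrArg (fun L ↦ L u) h3).trans ?_
  rfl

/-- The product metric is invariant under `(p, x) ↦ (φ p, c x)`, where `φ` is an isometry. -/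
theorem productMetric_scaleMap {g : BilinField E K} {φ : K → K}
    (hφ : ContMDiff 𝓘(ℂ, E) 𝓘(ℂ, E) ω φ)
    (hiso : ∀ x u v, g.form (φ x) (realDeriv (F := E) (F' := E) φ x u)
      (realDeriv (F := E) (F' := E) φ x v) = g.form x u v) {c : ℝ} (hc : c ≠ 0)
    (a : K × PuncturedC2) (u v : E × C2) :
    (productMetric g).form (scaleMap φ hc a)
      (realDeriv (F := E × C2) (F' := E × C2) (scaleMap φ hc) a u)
      (realDeriv (F := E × C2) (F' := E × C2) (scaleMap φ hc) a v)
      = (productMetric g).form a u v := by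
  rw [realDeriv_scaleMap hφ, realDeriv_scaleMap hφ, productMetric_apply, productMetric_apply]
  congr 1
  · exact hiso a.1 u.1 v.1
  · have hx : ‖(a.2 : C2)‖ ≠ 0 := norm_ne_zero_iff.2 a.2.2
    have hc' : |c| ≠ 0 := abs_ne_zero.2 hc
    -- Each of the two vectors contributes a factor c, and together they cancel the c² in ‖c x‖².
    change hopfMetric (c • (a.2 : C2)) (c • u.2) (c • v.2) = hopfMetric a.2 u.2 v.2
    simp only [hopfMetric_apply, map_smul, smul_apply, smul_eq_mul, norm_smul, Real.norm_eq_abs,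
      mul_pow, sq_abs]
    field_simp

theorem productMetric_isHermitianMetric [IsManifold 𝓘(ℂ, E) ω K] {g : BilinField E K}
    (hg : IsHermitianMetric g) : IsHermitianMetric (productMetric g) where
  symm a u v :=
    congrArg₂ (· + ·) (hg.symm a.1 _ _) (isHermitianOn_hopfMetric.symm _ a.2.2 _ _)
  pos a u hu := by
    have a1 : 0 ≤ g.form a.1 u.1 u.1 := by
      by_cases h : (u.1 : E) = 0
      · rw [h]
        simp
      · exact (hg.pos a.1 _ h).le
    have a2 : 0 ≤ hopfMetric a.2 u.2 u.2 := by
      by_cases h : u.2 = 0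
      · rw [h]
        simp
      · exact (isHermitianOn_hopfMetric.pos _ a.2.2 _ h).le
    change 0 < g.form a.1 u.1 u.1 + hopfMetric a.2 u.2 u.2
    by_cases h : u.1 = 0
    · have : u.2 ≠ 0 := fun h' ↦ hu (Prod.ext h h')
      exact add_pos_of_nonneg_of_pos a1 (isHermitianOn_hopfMetric.pos _ a.2.2 _ this)
    · exact add_pos_of_pos_of_nonneg (hg.pos a.1 _ h) a2
  compatible a u v :=
    congrArg₂ (· + ·) (hg.compatible a.1 _ _) (isHermitianOn_hopfMetric.compatible _ a.2.2 _ _)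
  smooth a := by
    refine ContDiffOn.congr ?_ fun y hy ↦ coordExpr_productMetric g a hy
    rw [productChartAt_target]
    exact ((hg.isHermitianOn a.1).prod isHermitianOn_hopfMetric).smooth

end ProductManifold

/-! ### Bismut curvature, torsion and Ricci form of Kähler times Hopf -/

namespace HermitianCoord

section Congruence

variable {F : Type*} [NormedAddCommGroup F] [NormedSpace ℂ F]
  {G G' : F → F →L[ℝ] F →L[ℝ] ℝ} {y : F}

theorem torsionForm_congr (h : G =ᶠ[𝓝 y] G') : torsionForm G y = torsionForm G' y := by
  have e : fundamentalForm G =ᶠ[𝓝 y] fundamentalForm G' := by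
    filter_upwards [h] with z hz
    simp [fundamentalForm, hz]
  funext u v
  simp [torsionForm, extDeriv₂, e.fderiv_eq]

theorem bismut_congr (h : G =ᶠ[𝓝 y] G') : bismut G y = bismut G' y := by
  funext u v
  simp [bismut, leviCivita, torsionForm_congr h, h.fderiv_eq, h.self_of_nhds]

end Congruence

section HopfProduct

variable {E : Type*} [NormedAddCommGroup E] [NormedSpace ℂ E] [FiniteDimensional ℂ E]
  {G₁ : E → E →L[ℝ] E →L[ℝ] ℝ} {U : Set E}
  {G : E × C2 → (E × C2) →L[ℝ] (E × C2) →L[ℝ] ℝ} {y : E × C2}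

/-- The Bismut curvature of the product of a Kähler metric and the metric `g_E / R²` is the
Riemannian curvature of the Kähler factor. -/
theorem curvature_bismut_hopf_product (h₁ : IsHermitianOn G₁ U) (hc : IsClosedOn G₁ U)
    (hy : y ∈ U ×ˢ ({0}ᶜ : Set C2)) (hG : G =ᶠ[𝓝 y] prodMetric G₁ hopfMetric)
    (u v w : E × C2) : curvature (bismut G) y u v w
      = (curvatureCLM (christoffel G₁) y.1 u.1 v.1 w.1, 0) := by
  have hopen : IsOpen (U ×ˢ ({0}ᶜ : Set C2)) := h₁.isOpen.prod isOpen_compl_singleton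
  have h : ∀ᶠ y' in 𝓝 y, ∀ u v, bismut G y' u v
      = (christoffel G₁ y'.1 u.1 v.1, hopfConnection y'.2 u.2 v.2) := by
    -- The coefficients at a nearby point z depend on the germ of the metric at z, hence
    -- `eventually_nhds`.
    filter_upwards [hopen.mem_nhds hy, hG.eventually_nhds] with z hz hz' u v
    rw [bismut_congr hz',
      bismut_prodMetric h₁ isHermitianOn_hopfMetric hz.1 hz.2, hc.bismut_eq hz.1,
      bismut_hopfMetric hz.2]
  rw [curvature_prod ((h₁.contDiffAt_christoffel hy.1).differentiableAt (by simp))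
    (differentiableAt_hopfConnection hy.2) h, curvatureCLM_hopfConnection hy.2]
  rfl

omit [FiniteDimensional ℂ E] in
/-- The product of a Kähler metric and the metric `g_E / R²` is pluriclosed. -/
theorem extDeriv₃_torsionForm_hopf_product (h₁ : IsHermitianOn G₁ U) (hc : IsClosedOn G₁ U)
    (hy : y ∈ U ×ˢ ({0}ᶜ : Set C2)) (hG : G =ᶠ[𝓝 y] prodMetric G₁ hopfMetric)
    (u v w z : E × C2) :
    extDeriv₃ (fun y u v w ↦ torsionForm G y u v w) y u v w z = 0 := by
  have hopen : IsOpen (U ×ˢ ({0}ᶜ : Set C2)) := h₁.isOpen.prod isOpen_compl_singleton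
  have h : ∀ u v w : E × C2, (fun y ↦ torsionForm G y u v w) =ᶠ[𝓝 y]
      (fun x ↦ torsionForm hopfMetric x u.2 v.2 w.2) ∘ Prod.snd := by
    intro u v w
    filter_upwards [hopen.mem_nhds hy, hG.eventually_nhds] with z hz hz'
    rw [torsionForm_congr hz',
      torsionForm_prodMetric (h₁.differentiableAt hz.1)
        (isHermitianOn_hopfMetric.differentiableAt hz.2)
        ((h₁.prod isHermitianOn_hopfMetric).differentiableAt hz), hc.torsionForm_eq_zero hz.1]
    simp
  have hd : ∀ u v w z : E × C2, fderiv ℝ (fun y ↦ torsionForm G y u v w) y z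
      = fderiv ℝ (fun x ↦ torsionForm hopfMetric x u.2 v.2 w.2) y.2 z.2 := by
    intro u v w z
    have hf := hasFDerivAt_torsionForm_hopfMetric (y := y.2) hy.2 u.2 v.2 w.2
    rw [(h u v w).fderiv_eq, (hf.comp y (hasFDerivAt_snd (𝕜 := ℝ))).fderiv, hf.fderiv]
    rfl
  rw [extDeriv₃, hd, hd, hd, hd]
  exact extDeriv₃_torsionForm_hopfMetric hy.2 u.2 v.2 w.2 z.2

/-- The Bismut Ricci form of the product of a Ricci-flat Kähler metric and the metric `g_E / R²`
vanishes. -/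
theorem sum_curvature_bismut_hopf_product (h₁ : IsHermitianOn G₁ U) (hc : IsClosedOn G₁ U)
    (hy : y ∈ U ×ˢ ({0}ᶜ : Set C2)) (hG : G =ᶠ[𝓝 y] prodMetric G₁ hopfMetric)
    (hRic : ∀ v w, LinearMap.trace ℝ E (ricciEnd (christoffel G₁) y.1 v w).toLinearMap = 0)
    {B : (E × C2) →L[ℝ] (E × C2) →L[ℝ] ℝ} {e : Fin (Module.finrank ℝ (E × C2)) → E × C2}
    (he : ∀ i j, B (e i) (e j) = if i = j then 1 else 0) (u v : E × C2) :
    ∑ i, B (curvature (bismut G) y u v (J (e i))) (e i) = 0 := by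
  have : FiniteDimensional ℝ E := FiniteDimensional.complexToReal E
  let B' : (E × C2) →ₗ[ℝ] (E × C2) →ₗ[ℝ] ℝ :=
    LinearMap.mk₂ ℝ (fun a b ↦ B a b) (by simp) (by simp) (by simp) (by simp)
  -- The endomorphism R^B(u, v) ∘ J is block diagonal with zero block on ℂ².
  let A : (E × C2) →ₗ[ℝ] (E × C2) := LinearMap.prodMap
    ((curvatureCLM (christoffel G₁) y.1 u.1 v.1).comp J).toLinearMap 0
  have h1 : ∑ i, B' (A (e i)) (e i) = LinearMap.trace ℝ (E × C2) A :=
    sum_orthonormal_eq_trace (B := B') he A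
  have h2 : LinearMap.trace ℝ (E × C2) A = 0 := by
    rw [LinearMap.trace_prodMap', h₁.trace_curvatureCLM_comp_J hc hy.1 hRic, map_zero, add_zero]
  rw [← h2, ← h1]
  refine Finset.sum_congr rfl fun i _ ↦ ?_
  rw [curvature_bismut_hopf_product h₁ hc hy hG]
  rfl

end HopfProduct

end HermitianCoord

/-! ### Ricci-flatness as a vanishing trace -/

section RicciFlat

open HermitianCoord

variable {F : Type*} [NormedAddCommGroup F] [NormedSpace ℂ F] [FiniteDimensional ℂ F]
  {M : Type*} [TopologicalSpace M] [ChartedSpace F M]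

theorem IsRicciFlat.trace_ricciEnd [IsManifold 𝓘(ℂ, F) ω M] {g : BilinField F M}
    (hg : IsHermitianMetric g) (hRic : IsRicciFlat g) (x : M) (v w : F) :
    LinearMap.trace ℝ F
      (ricciEnd (christoffel (coordExpr g x)) (chartAt F x x) v w).toLinearMap = 0 := by
  have : FiniteDimensional ℝ F := FiniteDimensional.complexToReal F
  let B : F →ₗ[ℝ] F →ₗ[ℝ] ℝ :=
    LinearMap.mk₂ ℝ (fun a b ↦ g.form x a b) (by simp) (by simp) (by simp) (by simp)
  obtain ⟨e, he⟩ := exists_orthonormal_frame (B := B) (hg.symm x) (hg.pos x)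
  rw [← sum_orthonormal_eq_trace he, ← hRic x e he v w]
  refine Finset.sum_congr rfl fun i _ ↦ ?_
  change g.form x (ricciEnd _ _ v w (e i)) (e i)
    = g.form x (curvature (leviCivita (coordExpr g x)) (chartAt F x x) (e i) v w) (e i)
  rw [ricciEnd_apply, hg.curvature_leviCivita]

end RicciFlat

/-! ### Powers of a holomorphic isometry -/

section HolomorphicIsometry

variable {E : Type*} [NormedAddCommGroup E] [NormedSpace ℂ E]
  {K : Type*} [TopologicalSpace K] [ChartedSpace E K]

/-- A holomorphic map which preserves the field of bilinear forms `g`. -/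
structure IsHolomorphicIsometry (g : BilinField E K) (φ : K → K) : Prop where
  contMDiff : ContMDiff 𝓘(ℂ, E) 𝓘(ℂ, E) ω φ
  isometry : ∀ (p : K) (u v : E), g.form (φ p) (realDeriv (F := E) (F' := E) φ p u)
    (realDeriv (F := E) (F' := E) φ p v) = g.form p u v

theorem realDeriv_comp {F₁ F₂ F₃ : Type*} [NormedAddCommGroup F₁] [NormedSpace ℂ F₁]
    [NormedAddCommGroup F₂] [NormedSpace ℂ F₂] [NormedAddCommGroup F₃] [NormedSpace ℂ F₃]
    {M₁ M₂ M₃ : Type*} [TopologicalSpace M₁] [ChartedSpace F₁ M₁] [TopologicalSpace M₂]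
    [ChartedSpace F₂ M₂] [TopologicalSpace M₃] [ChartedSpace F₃ M₃] {f : M₁ → M₂} {f' : M₂ → M₃}
    {x : M₁} (hf' : MDifferentiableAt (realModel F₂) (realModel F₃) f' (f x))
    (hf : MDifferentiableAt (realModel F₁) (realModel F₂) f x) (u : F₁) :
    realDeriv (F := F₁) (F' := F₃) (f' ∘ f) x u
      = realDeriv (F := F₂) (F' := F₃) f' (f x) (realDeriv (F := F₁) (F' := F₂) f x u) :=
  congrArg (fun L : F₁ →L[ℝ] F₃ ↦ L u) (mfderiv_comp x hf' hf)

theorem realDeriv_id (p : K) (u : E) : realDeriv (F := E) (F' := E) (id : K → K) p u = u :=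
  congrArg (fun L : E →L[ℝ] E ↦ L u) (mfderiv_id (I := realModel E) (x := p))

namespace IsHolomorphicIsometry

variable {g : BilinField E K} {φ φ' : K → K}

theorem mdifferentiableAt (h : IsHolomorphicIsometry g φ) (p : K) :
    MDifferentiableAt (realModel E) (realModel E) φ p :=
  (h.contMDiff p).to_real.mdifferentiableAt (by simp)

theorem id : IsHolomorphicIsometry g (id : K → K) where
  contMDiff := contMDiff_id
  isometry p u v := by simp only [realDeriv_id, _root_.id]

theorem comp (h' : IsHolomorphicIsometry g φ') (h : IsHolomorphicIsometry g φ) :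
    IsHolomorphicIsometry g (φ' ∘ φ) where
  contMDiff := h'.contMDiff.comp h.contMDiff
  isometry p u v := by
    rw [realDeriv_comp (h'.mdifferentiableAt _) (h.mdifferentiableAt p),
      realDeriv_comp (h'.mdifferentiableAt _) (h.mdifferentiableAt p), Function.comp_apply,
      h'.isometry, h.isometry]

theorem of_rightInverse (h : IsHolomorphicIsometry g φ)
    (hφ' : ContMDiff 𝓘(ℂ, E) 𝓘(ℂ, E) ω φ') (hinv : Function.RightInverse φ' φ) :
    IsHolomorphicIsometry g φ' where
  contMDiff := hφ'
  isometry p u v := by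
    have hd : MDifferentiableAt (realModel E) (realModel E) φ' p :=
      (hφ' p).to_real.mdifferentiableAt (by simp)
    have hc : φ ∘ φ' = _root_.id := hinv.id
    have key : ∀ w, realDeriv (F := E) (F' := E) φ (φ' p) (realDeriv (F := E) (F' := E) φ' p w)
        = w := by
      intro w
      rw [← realDeriv_comp (h.mdifferentiableAt _) hd, hc, realDeriv_id]
    rw [← h.isometry, key, key, hinv]

theorem zpow {ψ : K ≃ₜ K} (h : IsHolomorphicIsometry g ψ)
    (hsymm : ContMDiff 𝓘(ℂ, E) 𝓘(ℂ, E) ω ψ.symm) (n : ℤ) :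
    IsHolomorphicIsometry g (ψ ^ n : K ≃ₜ K) := by
  induction n with
  | zero => exact id
  | succ n ih =>
    rw [zpow_add_one]
    exact ih.comp h
  | pred n ih =>
    rw [zpow_sub_one]
    exact ih.comp (h.of_rightInverse hsymm ψ.apply_symm_apply)

end IsHolomorphicIsometry

end HolomorphicIsometry

/-! ### Deck transformations and local inverses of the covering -/

section Deck

variable {K : Type*} [TopologicalSpace K]

theorem two_zpow_ne_zero (n : ℤ) : (2 : ℝ) ^ n ≠ 0 := zpow_ne_zero n two_ne_zero

/-- The deck transformation `(p, x) ↦ (ψ ^ n p, 2 ^ n x)`. -/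
def deck (ψ : K ≃ₜ K) (n : ℤ) : K × PuncturedC2 → K × PuncturedC2 :=
  scaleMap (ψ ^ n : K ≃ₜ K) (two_zpow_ne_zero n)

theorem continuous_deck (ψ : K ≃ₜ K) (n : ℤ) : Continuous (deck ψ n) :=
  continuous_scaleMap (ψ ^ n).continuous _

/-- φ ↦ φ × id is a group homomorphism, so it commutes with integer powers. -/
theorem prodCongr_refl_zpow_apply {Y : Type*} [TopologicalSpace Y] (ψ : K ≃ₜ K) (n : ℤ)
    (a : K × Y) : ((ψ.prodCongr (Homeomorph.refl Y)) ^ n) a = ((ψ ^ n) a.1, a.2) := by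
  let P : (K ≃ₜ K) →* (K × Y ≃ₜ K × Y) := MonoidHom.mk' (fun φ ↦ φ.prodCongr (Homeomorph.refl Y))
    fun _ _ ↦ rfl
  exact congrArg (fun φ : K × Y ≃ₜ K × Y ↦ φ a) (map_zpow P ψ n).symm

/-- Scaling by 2 ^ n keeps x / ‖x‖ and adds n to log₂ ‖x‖, which turns the deck action into the
action defining the mapping torus. -/
theorem polarHomeomorph_deck (ψ : K ≃ₜ K) (n : ℤ) (a : K × PuncturedC2) :
    polarHomeomorph K (deck ψ n a) = (((ψ.prodCongr (Homeomorph.refl S3)) ^ n)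
      (polarHomeomorph K a).1, (polarHomeomorph K a).2 + n) := by
  have hx : ‖(a.2 : C2)‖ ≠ 0 := norm_ne_zero_iff.2 a.2.2
  have h2 : (2 : ℝ) ^ n ≠ 0 := two_zpow_ne_zero n
  have hn : ‖(2 : ℝ) ^ n • (a.2 : C2)‖ = 2 ^ n * ‖(a.2 : C2)‖ := by
    rw [norm_smul, Real.norm_of_nonneg (by positivity)]
  rw [prodCongr_refl_zpow_apply]
  refine Prod.ext (Prod.ext rfl (Subtype.ext ?_)) ?_
  · change ‖(2 : ℝ) ^ n • (a.2 : C2)‖⁻¹ • ((2 : ℝ) ^ n • (a.2 : C2)) = ‖(a.2 : C2)‖⁻¹ • (a.2 : C2)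
    rw [hn, smul_smul]
    congr 1
    field_simp
  · change Real.logb 2 ‖(2 : ℝ) ^ n • (a.2 : C2)‖ = Real.logb 2 ‖(a.2 : C2)‖ + n
    rw [hn, Real.logb_mul h2 hx, add_comm, ← Real.rpow_intCast, Real.logb_rpow two_pos (by norm_num)]

theorem torusCover_deck (ψ : K ≃ₜ K) (n : ℤ) (a : K × PuncturedC2) :
    torusCover ψ (deck ψ n a) = torusCover ψ a := by
  rw [torusCover, polarHomeomorph_deck]
  exact Quotient.sound ⟨n, rfl⟩

theorem exists_deck_eq {ψ : K ≃ₜ K} {a b : K × PuncturedC2} (h : torusCover ψ a = torusCover ψ b) :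
    ∃ n, deck ψ n b = a := by
  obtain ⟨n, hn⟩ := Quotient.exact h
  exact ⟨n, (polarHomeomorph K).injective ((polarHomeomorph_deck ψ n b).trans hn)⟩

end Deck

section TorusLift

variable {K : Type*} [TopologicalSpace K] {ψ : K ≃ₜ K}

variable (ψ) in
/-- The preimages of the points of the mapping torus used in the definition of its atlas. -/
def torusLift (m : KahlerTorus ψ) : K × PuncturedC2 :=
  -- This is the choice made by the atlas, so `torusChartAt` holds by definition. `torusMetric` uses
  -- `Function.surjInv`, possibly another preimage.
  (torusCover_surjective ψ).hasRightInverse.choose m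

theorem torusCover_torusLift (m : KahlerTorus ψ) : torusCover ψ (torusLift ψ m) = m :=
  (torusCover_surjective ψ).hasRightInverse.choose_spec m

variable [CompactSpace K] [T2Space K]

theorem continuous_torusCover : Continuous (torusCover ψ) :=
  (torusCover_isLocalHomeomorph ψ).continuous

/-- Composed with the covering map, a local inverse of it is locally a deck transformation. -/
theorem localInverseAt_torusCover {c b : K × PuncturedC2}
    (hb : torusCover ψ b ∈ ((torusCover_isLocalHomeomorph ψ).localInverseAt c).source) :
    ∃ n, ((torusCover_isLocalHomeomorph ψ).localInverseAt c ∘ torusCover ψ) =ᶠ[𝓝 b] deck ψ n := by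
  set L := (torusCover_isLocalHomeomorph ψ).localInverseAt c with hL
  have hsymm : (L.symm : K × PuncturedC2 → KahlerTorus ψ) = torusCover ψ :=
    (torusCover_isLocalHomeomorph ψ).localInverseAt_symm c
  have h1 : torusCover ψ (L (torusCover ψ b)) = torusCover ψ b :=
    (torusCover_isLocalHomeomorph ψ).apply_localInverseAt_of_mem hb
  obtain ⟨n, hn⟩ := exists_deck_eq h1
  refine ⟨n, ?_⟩
  have h2 : deck ψ n b ∈ L.target := hn ▸ L.map_source hb
  filter_upwards [(continuous_deck ψ n).continuousAt.preimage_mem_nhds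
    (L.open_target.mem_nhds h2)] with b' hb'
  -- The points b' and `deck ψ n b'` have the same image, and the latter lies in the target of `L`,
  -- where `L` inverts the covering map.
  rw [Function.comp_apply, ← torusCover_deck ψ n b', ← hsymm]
  exact L.right_inv hb'

end TorusLift

/-! ### The complex atlas of the mapping torus -/

section TorusChart

variable {E : Type*} [NormedAddCommGroup E]
  {K : Type*} [TopologicalSpace K] [CompactSpace K] [T2Space K] [ChartedSpace E K] {ψ : K ≃ₜ K}

theorem torusChartAt (m : KahlerTorus ψ) : chartAt (E × C2) m
    = ((torusCover_isLocalHomeomorph ψ).localInverseAt (torusLift ψ m)).trans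
      (chartAt (E × C2) (torusLift ψ m)) := rfl

theorem torusChartAt_symm_apply (m : KahlerTorus ψ) (y : E × C2) :
    (chartAt (E × C2) m).symm y
      = torusCover ψ ((chartAt (E × C2) (torusLift ψ m)).symm y) := by
  rw [← (torusCover_isLocalHomeomorph ψ).localInverseAt_symm (x := torusLift ψ m)]
  rfl

theorem torusChartAt_target_subset (m : KahlerTorus ψ) :
    (chartAt (E × C2) m).target ⊆ (chartAt (E × C2) (torusLift ψ m)).target := by
  rw [torusChartAt, OpenPartialHomeomorph.trans_target]
  exact Set.inter_subset_left

theorem torusChartAt_self (m : KahlerTorus ψ) :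
    chartAt (E × C2) m m = chartAt (E × C2) (torusLift ψ m) (torusLift ψ m) := by
  have h := (torusCover_isLocalHomeomorph ψ).localInverseAt_apply_self (x := torusLift ψ m)
  rw [torusCover_torusLift] at h
  exact congrArg (chartAt (E × C2) (torusLift ψ m)) h

/-- Near any point, the covering map is in the charts a deck transformation. -/
theorem exists_deck_coord (b : K × PuncturedC2) :
    ∃ n, deck ψ n b = torusLift ψ (torusCover ψ b) ∧
      (chartAt (E × C2) (torusCover ψ b) ∘ torusCover ψ ∘ (chartAt (E × C2) b).symm)
        =ᶠ[𝓝 (chartAt (E × C2) b b)]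
      (chartAt (E × C2) (deck ψ n b) ∘ deck ψ n ∘ (chartAt (E × C2) b).symm) := by
  set m := torusCover ψ b with hm
  have hb : torusCover ψ b
      ∈ ((torusCover_isLocalHomeomorph ψ).localInverseAt (torusLift ψ m)).source := by
    have := (torusCover_isLocalHomeomorph ψ).apply_self_mem_localInverseAt_source
      (x := torusLift ψ m)
    rwa [torusCover_torusLift] at this
  obtain ⟨n, hn⟩ := localInverseAt_torusCover hb
  have h1 : deck ψ n b = torusLift ψ m := by
    rw [← hn.self_of_nhds, Function.comp_apply, ← hm]
    have := (torusCover_isLocalHomeomorph ψ).localInverseAt_apply_self (x := torusLift ψ m)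
    rwa [torusCover_torusLift] at this
  refine ⟨n, h1, ?_⟩
  have hc : Filter.Tendsto (chartAt (E × C2) b).symm (𝓝 (chartAt (E × C2) b b)) (𝓝 b) := by
    have := (chartAt (E × C2) b).continuousAt_symm (mem_chart_target (E × C2) b)
    rwa [ContinuousAt, (chartAt (E × C2) b).left_inv (mem_chart_source _ b)] at this
  filter_upwards [hc.eventually hn] with z hz
  rw [h1]
  exact congrArg (chartAt (E × C2) (torusLift ψ m)) hz

theorem torusChartAt_self_mem (m : KahlerTorus ψ) :
    chartAt (E × C2) m m ∈ (chartAt E (torusLift ψ m).1).target ×ˢ ({0}ᶜ : Set C2) := by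
  rw [← productChartAt_target]
  exact torusChartAt_target_subset m (mem_chart_target _ m)

end TorusChart

section TorusManifold

variable {E : Type*} [NormedAddCommGroup E] [NormedSpace ℂ E]
  {K : Type*} [TopologicalSpace K] [ChartedSpace E K] {ψ : K ≃ₜ K}

/-- The deck transformations are holomorphic. -/
theorem contMDiff_deck (hψ : ∀ n : ℤ, ContMDiff 𝓘(ℂ, E) 𝓘(ℂ, E) ω (ψ ^ n : K ≃ₜ K)) (n : ℤ) :
    ContMDiff 𝓘(ℂ, E × C2) 𝓘(ℂ, E × C2) ω (deck ψ n) :=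
  contMDiff_scaleMap (hψ n) _

variable [CompactSpace K] [T2Space K]

/-- The mapping torus is a complex manifold. -/
theorem torusIsManifold [IsManifold 𝓘(ℂ, E) ω K]
    (hψ : ∀ n : ℤ, ContMDiff 𝓘(ℂ, E) 𝓘(ℂ, E) ω (ψ ^ n : K ≃ₜ K)) :
    IsManifold 𝓘(ℂ, E × C2) ω (KahlerTorus ψ) := by
  refine isManifold_of_contDiffOn _ _ _ ?_
  rintro e e' ⟨m, rfl⟩ ⟨m', rfl⟩
  change ContDiffOn ℂ ω (chartAt (E × C2) m' ∘ (chartAt (E × C2) m).symm) _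
  rintro y ⟨hy, -⟩
  have hy1 : y ∈ (chartAt (E × C2) m).target := hy.1
  have hy2 : (chartAt (E × C2) m).symm y ∈ (chartAt (E × C2) m').source := hy.2
  have hy3 := torusChartAt_target_subset m hy1
  rw [torusChartAt_symm_apply, torusChartAt m', OpenPartialHomeomorph.trans_source] at hy2
  -- A transition map of the torus is, near each point, a deck transformation read in product
  -- charts.
  obtain ⟨n, hn⟩ := localInverseAt_torusCover hy2.1
  have hc : ContinuousAt (chartAt (E × C2) (torusLift ψ m)).symm y :=
    (chartAt (E × C2) (torusLift ψ m)).continuousAt_symm hy3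
  have hdom : y ∈ coordDomain (F := E × C2) (deck ψ n) (torusLift ψ m) (torusLift ψ m') := by
    refine ⟨hy3, ?_⟩
    have := hy2.2
    rw [Set.mem_preimage] at this
    rw [Set.mem_preimage, Set.mem_preimage, ← hn.self_of_nhds]
    exact this
  refine ContDiffAt.contDiffWithinAt ?_
  refine (contDiffAt_coordMap (contMDiff_deck hψ n) hdom).congr_of_eventuallyEq ?_
  filter_upwards [hc.eventually hn] with z hz
  change chartAt (E × C2) (torusLift ψ m') ((torusCover_isLocalHomeomorph ψ).localInverseAt
    (torusLift ψ m') ((chartAt (E × C2) m).symm z)) = chartAt (E × C2) (torusLift ψ m') _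
  rw [torusChartAt_symm_apply]
  exact congrArg _ hz

/-- The covering map is holomorphic. -/
theorem contMDiff_torusCover
    (hψ : ∀ n : ℤ, ContMDiff 𝓘(ℂ, E) 𝓘(ℂ, E) ω (ψ ^ n : K ≃ₜ K)) :
    ContMDiff 𝓘(ℂ, E × C2) 𝓘(ℂ, E × C2) ω (torusCover ψ) := by
  intro b
  obtain ⟨n, -, hn⟩ := exists_deck_coord (E := E) (ψ := ψ) b
  exact contMDiffAt_self_iff.2 ⟨continuous_torusCover.continuousAt,
    (contMDiffAt_self_iff.1 (contMDiff_deck hψ n b)).2.congr_of_eventuallyEq hn⟩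

/-- The differential of the covering map is that of a deck transformation. -/
theorem exists_realDeriv_torusCover
    (hψ : ∀ n : ℤ, ContMDiff 𝓘(ℂ, E) 𝓘(ℂ, E) ω (ψ ^ n : K ≃ₜ K)) (b : K × PuncturedC2) :
    ∃ n, deck ψ n b = torusLift ψ (torusCover ψ b) ∧
      realDeriv (F := E × C2) (F' := E × C2) (torusCover ψ) b
        = realDeriv (F := E × C2) (F' := E × C2) (deck ψ n) b := by
  obtain ⟨n, h1, hn⟩ := exists_deck_coord (E := E) (ψ := ψ) b
  refine ⟨n, h1, ?_⟩
  rw [realDeriv_eq ((contMDiff_torusCover hψ b).to_real.mdifferentiableAt (by simp)),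
    realDeriv_eq ((contMDiff_deck hψ n b).to_real.mdifferentiableAt (by simp)), hn.fderiv_eq]

end TorusManifold

/-! ### The induced metric and its Bismut curvature -/

section TorusMetric

open HermitianCoord

variable {E : Type*} [NormedAddCommGroup E] [NormedSpace ℂ E]
  {K : Type*} [TopologicalSpace K] [CompactSpace K] [T2Space K] [ChartedSpace E K]
  {ψ : K ≃ₜ K} {g : BilinField E K}

/-- The product metric at a preimage of a point of the mapping torus is the pullback of the product
metric at the preferred preimage. -/
theorem productMetric_torusLift (hψ : ∀ n : ℤ, IsHolomorphicIsometry g (ψ ^ n : K ≃ₜ K))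
    (a : K × PuncturedC2) (u v : E × C2) :
    (productMetric g).form (torusLift ψ (torusCover ψ a))
      (realDeriv (F := E × C2) (F' := E × C2) (torusCover ψ) a u)
      (realDeriv (F := E × C2) (F' := E × C2) (torusCover ψ) a v)
      = (productMetric g).form a u v := by
  obtain ⟨n, h1, h2⟩ := exists_realDeriv_torusCover (E := E) (fun n ↦ (hψ n).contMDiff) a
  rw [← h1, h2]
  exact productMetric_scaleMap (hψ n).contMDiff (hψ n).isometry _ a u v

variable [IsManifold 𝓘(ℂ, E) ω K] [FiniteDimensional ℂ E]

theorem isInvertible_realDeriv_torusCover (hg : IsHermitianMetric g)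
    (hψ : ∀ n : ℤ, IsHolomorphicIsometry g (ψ ^ n : K ≃ₜ K)) (a : K × PuncturedC2) :
    (realDeriv (F := E × C2) (F' := E × C2) (torusCover ψ) a).IsInvertible := by
  have : FiniteDimensional ℝ E := FiniteDimensional.complexToReal E
  set D := realDeriv (F := E × C2) (F' := E × C2) (torusCover ψ) a with hD
  have hinj : Function.Injective D := by
    rw [injective_iff_map_eq_zero]
    intro u hu
    by_contra h
    have h1 : 0 < (productMetric g).form a u u := (productMetric_isHermitianMetric hg).pos a u h
    rw [← productMetric_torusLift hψ, ← hD, hu] at h1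
    simp at h1
  exact ⟨(LinearEquiv.ofInjectiveEndo D.toLinearMap hinj).toContinuousLinearEquiv, by ext <;> rfl⟩

/-- The tangent space at m is identified with the model through the chart built on `torusLift ψ m`.
In these terms the differential of the covering at any preimage is an isometry onto the product
metric at that lift, which removes the choice of preimage. -/
theorem torusMetric_form (hg : IsHermitianMetric g)
    (hψ : ∀ n : ℤ, IsHolomorphicIsometry g (ψ ^ n : K ≃ₜ K)) (m : KahlerTorus ψ) :
    (torusMetric g ψ).form m = (productMetric g).form (torusLift ψ m) := by
  have key : ∀ u v : E × C2, (torusMetric g ψ).form m u v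
      = (productMetric g).form (torusLift ψ m) u v := by
    intro u v
    set a := Function.surjInv (torusCover_surjective ψ) m with ha
    set D := realDeriv (F := E × C2) (F' := E × C2) (torusCover ψ) a with hD
    have h1 : torusCover ψ a = m := Function.surjInv_eq _ m
    have h2 : ∀ w, D (D.inverse w) = w := by
      obtain ⟨e, he⟩ := isInvertible_realDeriv_torusCover hg hψ a
      intro w
      rw [hD, ← he, ContinuousLinearMap.inverse_equiv]
      exact e.apply_symm_apply w
    change (productMetric g).form a (D.inverse u) (D.inverse v) = _
    rw [← productMetric_torusLift hψ, ← hD, h2, h2, h1]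
  exact ContinuousLinearMap.ext fun u ↦ ContinuousLinearMap.ext fun v ↦ key u v

theorem torusMetric_pullback (hg : IsHermitianMetric g)
    (hψ : ∀ n : ℤ, IsHolomorphicIsometry g (ψ ^ n : K ≃ₜ K)) (a : K × PuncturedC2)
    (u v : E × C2) :
    (torusMetric g ψ).form (torusCover ψ a)
      (realDeriv (F := E × C2) (F' := E × C2) (torusCover ψ) a u)
      (realDeriv (F := E × C2) (F' := E × C2) (torusCover ψ) a v)
      = (productMetric g).form a u v := by
  rw [torusMetric_form hg hψ, productMetric_torusLift hψ]

/-- From the product chart at `torusLift ψ m` to the torus chart at m the covering map reads as the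
identity, and h pulls back to the product metric. -/
theorem coordExpr_torusMetric (hg : IsHermitianMetric g)
    (hψ : ∀ n : ℤ, IsHolomorphicIsometry g (ψ ^ n : K ≃ₜ K)) (m : KahlerTorus ψ) {y : E × C2}
    (hy : y ∈ (chartAt (E × C2) m).target) :
    coordExpr (torusMetric g ψ) m y = prodMetric (coordExpr g (torusLift ψ m).1) hopfMetric y := by
  have hc : ∀ n : ℤ, ContMDiff 𝓘(ℂ, E) 𝓘(ℂ, E) ω (ψ ^ n : K ≃ₜ K) := fun n ↦ (hψ n).contMDiff
  have := torusIsManifold hc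
  have := isManifold_real (E × C2) (KahlerTorus ψ)
  have := isManifold_real (E × C2) (K × PuncturedC2)
  have hy' := torusChartAt_target_subset m hy
  rw [← coordExpr_productMetric g _ hy']
  have hdom : y ∈ coordDomain (F := E × C2) (torusCover ψ) (torusLift ψ m) m := by
    refine ⟨hy', ?_⟩
    have := (chartAt (E × C2) m).map_target hy
    rwa [torusChartAt_symm_apply] at this
  have e : coordMap (F := E × C2) (torusCover ψ) (torusLift ψ m) m =ᶠ[𝓝 y] id := by
    filter_upwards [(chartAt (E × C2) m).open_target.mem_nhds hy] with z hz
    rw [coordMap, Function.comp_apply, Function.comp_apply, ← torusChartAt_symm_apply]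
    exact (chartAt (E × C2) m).right_inv hz
  have hd := fun x ↦ ((contMDiff_torusCover hc x).to_real).mdifferentiableAt (by simp)
  have key : ∀ u v : E × C2, coordExpr (torusMetric g ψ) m y u v
      = coordExpr (productMetric g) (torusLift ψ m) y u v := by
    intro u v
    rw [coordExpr_pullback (g := productMetric g) (g' := torusMetric g ψ) hdom (hd _)
      fun u v ↦ torusMetric_pullback hg hψ _ u v, e.fderiv_eq, e.self_of_nhds, fderiv_id]
    rfl
  exact ContinuousLinearMap.ext fun u ↦ ContinuousLinearMap.ext fun v ↦ key u v

theorem torusMetric_isHermitianMetric (hg : IsHermitianMetric g)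
    (hψ : ∀ n : ℤ, IsHolomorphicIsometry g (ψ ^ n : K ≃ₜ K)) :
    IsHermitianMetric (torusMetric g ψ) where
  symm m u v := by
    change (torusMetric g ψ).form m u v = (torusMetric g ψ).form m v u
    rw [torusMetric_form hg hψ]
    exact (productMetric_isHermitianMetric hg).symm _ _ _
  pos m u hu := by
    change 0 < (torusMetric g ψ).form m u u
    rw [torusMetric_form hg hψ]
    exact (productMetric_isHermitianMetric hg).pos _ _ hu
  compatible m u v := by
    change (torusMetric g ψ).form m (tangentJ m u) (tangentJ m v) = (torusMetric g ψ).form m u v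
    rw [torusMetric_form hg hψ]
    exact (productMetric_isHermitianMetric hg).compatible _ _ _
  smooth m := by
    refine ContDiffOn.congr (ContDiffOn.mono (((hg.isHermitianOn _).prod
      isHermitianOn_hopfMetric).smooth) ?_) fun y hy ↦ coordExpr_torusMetric hg hψ m hy
    rw [← productChartAt_target]
    exact torusChartAt_target_subset m

theorem coordExpr_torusMetric_eventuallyEq (hg : IsHermitianMetric g)
    (hψ : ∀ n : ℤ, IsHolomorphicIsometry g (ψ ^ n : K ≃ₜ K)) (m : KahlerTorus ψ) :
    coordExpr (torusMetric g ψ) m =ᶠ[𝓝 (chartAt (E × C2) m m)]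
      prodMetric (coordExpr g (torusLift ψ m).1) hopfMetric := by
  filter_upwards [(chartAt (E × C2) m).open_target.mem_nhds (mem_chart_target _ m)] with y hy
  exact coordExpr_torusMetric hg hψ m hy

theorem torusMetric_isSKTMetric (hg : IsKahlerMetric g)
    (hψ : ∀ n : ℤ, IsHolomorphicIsometry g (ψ ^ n : K ≃ₜ K)) : IsSKTMetric (torusMetric g ψ) where
  toIsHermitianMetric := torusMetric_isHermitianMetric hg.toIsHermitianMetric hψ
  closed m := extDeriv₃_torsionForm_hopf_product (hg.isHermitianOn _) (hg.isClosedOn _)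
    (torusChartAt_self_mem m) (coordExpr_torusMetric_eventuallyEq hg.toIsHermitianMetric hψ m)

theorem torusMetric_isCYT (hg : IsKahlerMetric g) (hRic : IsRicciFlat g)
    (hψ : ∀ n : ℤ, IsHolomorphicIsometry g (ψ ^ n : K ≃ₜ K)) : IsCYT (torusMetric g ψ) := by
  intro m e he u v
  have h := sum_curvature_bismut_hopf_product (hg.isHermitianOn _) (hg.isClosedOn _)
    (torusChartAt_self_mem m) (coordExpr_torusMetric_eventuallyEq hg.toIsHermitianMetric hψ m)
    (B := (torusMetric g ψ).form m) (e := e) (by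
      rw [torusChartAt_self]
      exact hRic.trace_ricciEnd hg.toIsHermitianMetric _) he u v
  exact (congrArg (fun s : ℝ ↦ 1 / 2 * s) h).trans (mul_zero _)

theorem bismutCurvature_torusMetric (hg : IsKahlerMetric g)
    (hψ : ∀ n : ℤ, IsHolomorphicIsometry g (ψ ^ n : K ≃ₜ K)) (m : KahlerTorus ψ)
    (u v w z : E × C2) : bismutCurvature (torusMetric g ψ) m u v w z
      = riemannCurvature g (torusLift ψ m).1 u.1 v.1 w.1 z.1 := by
  change (torusMetric g ψ).form m (curvature (bismut (coordExpr (torusMetric g ψ) m))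
    (chartAt (E × C2) m m) u v w) z = g.form (torusLift ψ m).1 (curvature
      (leviCivita (coordExpr g (torusLift ψ m).1)) (chartAt E _ (torusLift ψ m).1) u.1 v.1 w.1) z.1
  rw [torusMetric_form hg.toIsHermitianMetric hψ, curvature_bismut_hopf_product
    (hg.isHermitianOn _) (hg.isClosedOn _) (torusChartAt_self_mem m)
    (coordExpr_torusMetric_eventuallyEq hg.toIsHermitianMetric hψ m), productMetric_apply,
    hg.curvature_leviCivita, torusChartAt_self, map_zero]
  exact add_zero _

/-- The Bismut curvature of the mapping torus is the Riemannian curvature of the Kähler factor. -/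
theorem bismutCurvature_torusCover (hg : IsKahlerMetric g)
    (hψ : ∀ n : ℤ, IsHolomorphicIsometry g (ψ ^ n : K ≃ₜ K)) (a : K × PuncturedC2)
    (u v w z : E × C2) : bismutCurvature (torusMetric g ψ) (torusCover ψ a)
      (realDeriv (F := E × C2) (F' := E × C2) (torusCover ψ) a u)
      (realDeriv (F := E × C2) (F' := E × C2) (torusCover ψ) a v)
      (realDeriv (F := E × C2) (F' := E × C2) (torusCover ψ) a w)
      (realDeriv (F := E × C2) (F' := E × C2) (torusCover ψ) a z)
      = riemannCurvature g a.1 u.1 v.1 w.1 z.1 := by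
  obtain ⟨n, h1, h2⟩ := exists_realDeriv_torusCover (E := E) (fun n ↦ (hψ n).contMDiff) a
  -- Along K the differential of the covering is that of ψ ^ n, so the curvature at the preferred
  -- lift is moved back to the given preimage by invariance under this isometry.
  have h3 : ∀ x, realDeriv (F := E × C2) (F' := E × C2) (torusCover ψ) a x = _ := fun x ↦
    (congrArg (fun L ↦ L x) h2).trans (realDeriv_scaleMap (hψ n).contMDiff _ a x)
  rw [h3, h3, h3, h3, bismutCurvature_torusMetric hg hψ, ← h1]
  exact riemannCurvature_isometry hg.toIsHermitianMetric
    (fun p ↦ ((hψ n).contMDiff p).to_real) (hψ n).isometry a.1 u.1 v.1 w.1 z.1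

end TorusMetric

theorem mainTheorem3 {E : Type*} [NormedAddCommGroup E] [NormedSpace ℂ E] [FiniteDimensional ℂ E]
    {K : Type*} [TopologicalSpace K] [CompactSpace K] [T2Space K] [ChartedSpace E K]
    [IsManifold 𝓘(ℂ, E) ω K]
    (g : BilinField E K) (hg : IsKahlerMetric g)
    (ψ : K ≃ₘ^ω⟮𝓘(ℂ, E), 𝓘(ℂ, E)⟯ K)
    (hψ : ∀ (p : K) (u v : TangentSpace (realModel E) p),
      g (ψ p) (mfderiv (realModel E) (realModel E) ψ p u)
        (mfderiv (realModel E) (realModel E) ψ p v) = g p u v)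
    (hRicci : IsRicciFlat g) (hflat : ¬ IsRiemannFlat g) :
    IsManifold 𝓘(ℂ, E × C2) ω (KahlerTorus ψ.toHomeomorph) ∧
    (∀ (a : K × PuncturedC2) (u v : TangentSpace (realModel (E × C2)) a),
      torusMetric g ψ.toHomeomorph (torusCover ψ.toHomeomorph a)
        (torusCoverDeriv (E := E) ψ.toHomeomorph a u)
        (torusCoverDeriv (E := E) ψ.toHomeomorph a v) = productMetric g a u v) ∧
    IsSKTMetric (torusMetric g ψ.toHomeomorph) ∧
    IsCYT (torusMetric g ψ.toHomeomorph) ∧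
    ¬ IsBismutFlat (torusMetric g ψ.toHomeomorph) ∧
    (∀ (p : K) (x : PuncturedC2) (u v w z : E × C2),
      bismutCurvature (torusMetric g ψ.toHomeomorph) (torusCover ψ.toHomeomorph (p, x))
        (torusCoverDeriv (E := E) ψ.toHomeomorph (p, x) u)
        (torusCoverDeriv (E := E) ψ.toHomeomorph (p, x) v)
        (torusCoverDeriv (E := E) ψ.toHomeomorph (p, x) w)
        (torusCoverDeriv (E := E) ψ.toHomeomorph (p, x) z)
      = riemannCurvature g p u.1 v.1 w.1 z.1) := by
  have hg' : IsHermitianMetric g := hg.toIsHermitianMetric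
  have h : ∀ n : ℤ, IsHolomorphicIsometry g (ψ.toHomeomorph ^ n : K ≃ₜ K) :=
    IsHolomorphicIsometry.zpow (ψ := ψ.toHomeomorph) ⟨ψ.contMDiff, hψ⟩ ψ.symm.contMDiff
  have hcurv := bismutCurvature_torusCover hg h
  refine ⟨torusIsManifold fun n ↦ (h n).contMDiff, torusMetric_pullback hg' h,
    torusMetric_isSKTMetric hg h, torusMetric_isCYT hg hRicci h, fun hB ↦ hflat ?_,
    fun p x ↦ hcurv (p, x)⟩
  intro p u v w z
  -- Any x ≠ 0 serves: vectors (u, 0) at (p, x) recover the whole curvature tensor of g at p,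
  -- contradicting non-flatness.
  obtain ⟨x, hx⟩ := exists_ne (0 : C2)
  exact (hcurv (p, ⟨x, hx⟩) (u, 0) (v, 0) (w, 0) (z, 0)).symm.trans (hB _ _ _ _ _)
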